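/- Let $AdS_3$ be the $3$-dimensional anti-de Sitter space, i.e. the quotient by $x\mapsto -x$ of the quadric $\{x\in\mathbb R^4 : \langle x,x\rangle=-1\}$, where $\langle x,y\rangle=-x_0y_0+x_1y_1+x_2y_2-x_3y_3$, with the induced Lorentzian metric of constant curvature $-1$ and the time orientation given by the vector field $(-x_3,0,0,x_0)$. A GHMC $AdS_3$ manifold is a connected time-oriented Lorentzian $3$-manifold $M$, locally isometric to $AdS_3$, that is globally hyperbolic with a compact Cauchy surface (a space-like surface met exactly once by every inextendible causal curve) and maximal: every isometric embedding of $M$ in another manifold locally isometric to $AdS_3$ which sends a Cauchy surface to a Cauchy surface is onto. For a space-like surface $S$ with future-directed unit normal field $\nu$, the shape operator is $B(X)=-\nabla_X\nu$, the principal curvatures $\lambda_1\ge\lambda_2$ are the eigenvalues of $B$, and the mean curvature is $\tfrac12\operatorname{tr}B$. Let $H\in\mathbb R$ and let $S$ be a smooth embedded space-like surface in $AdS_3$ of constant mean curvature $H$. Suppose that $S$ is the lift of a closed (compact, without boundary) space-like surface $F$ embedded in a GHMC $AdS_3$ manifold $M$; that is, $S$ is the image, under a developing map of the universal cover of $M$,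 of a connected component of the preimage of $F$, which the developing map embeds in $AdS_3$. Then at every point of $S$ the principal curvatures satisfy $$H\le\lambda_1\le \sqrt{H^2+1}+H\qquad\text{and}\qquad -\sqrt{H^2+1}+H\le\lambda_2\le H .$$ -/

import Mathlib

open scoped Manifold Topology ContDiff

universe u

noncomputable section

namespace AdS

/-! # The quadric model and anti-de Sitter space -/

/-- The ambient space `ℝ⁴`, with coordinates `x₀, x₁, x₂, x₃`. -/
abbrev E4 : Type := Fin 4 → ℝ

/-- The parameter space `ℝ²` of surfaces. -/
abbrev E2 : Type := Fin 2 → ℝ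

/-- The symmetric bilinear form of signature `(2,2)`. -/
def form (x y : E4) : ℝ := -(x 0 * y 0) + x 1 * y 1 + x 2 * y 2 - x 3 * y 3

/-- The quadric `⟨x, x⟩ = -1`, with the topology of `ℝ⁴`. Its Lorentzian metric is the restriction
of `form` to the tangent spaces `{v | ⟨x, v⟩ = 0}`. -/
abbrev Quadric : Type := {x : E4 // form x x = -1}

/-- The time-like (rotation) vector field `∂/∂θ = (-x₃, 0, 0, x₀)`, which defines the time
orientation. -/
def timeField (x : E4) : E4 := ![-(x 3), 0, 0, x 0]

/-- The (causal) tangent vector `v` at `x` is future-directed. -/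
def IsFuture (x v : E4) : Prop := form v (timeField x) < 0

/-- The antipodal relation on the quadric. -/
def antipodalSetoid : Setoid Quadric where
  r x y := (x : E4) = y ∨ (x : E4) = -(y : E4)
  iseqv := by
    refine ⟨fun x => Or.inl rfl, ?_, ?_⟩
    · rintro x y (h | h)
      · exact Or.inl h.symm
      · exact Or.inr (by rw [h, neg_neg])
    · rintro x y z (h | h) (h' | h')
      · exact Or.inl (h.trans h')
      · exact Or.inr (h.trans h')
      · exact Or.inr (by rw [h, h'])
      · exact Or.inl (by rw [h, h', neg_neg])

/-- Anti-de Sitter space `AdS₃`: the image in projective space of the negative vectors, that is, the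
quadric modulo the antipodal map, with the quotient topology. The time orientation of the quadric
is invariant under the antipodal map. -/
def AdS3 : Type := Quotient antipodalSetoid

instance : TopologicalSpace AdS3 :=
  inferInstanceAs (TopologicalSpace (Quotient antipodalSetoid))

/-- The double covering `Quadric → AdS₃`. -/
def proj (x : Quadric) : AdS3 := Quotient.mk antipodalSetoid x

/-! # Manifolds locally modelled on `AdS₃` -/

/-- `A` is a time-orientation preserving linear isometry of the form: the isometries of the quadric
that preserve its time orientation. -/
structure IsIsometry (A : E4 →ₗ[ℝ] E4) : Prop where
  form_map : ∀ x y, form (A x) (A y) = form x y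
  future_map : ∀ x v, form x x = -1 → form x v = 0 → form v v < 0 → IsFuture x v →
    IsFuture (A x) (A v)

theorem IsIsometry.id : IsIsometry LinearMap.id := ⟨fun _ _ => rfl, fun _ _ _ _ _ h => h⟩

theorem IsIsometry.comp {A B : E4 →ₗ[ℝ] E4} (hA : IsIsometry A) (hB : IsIsometry B) :
    IsIsometry (A.comp B) where
  form_map x y := (hA.form_map _ _).trans (hB.form_map _ _)
  future_map x v h1 h2 h3 h4 :=
    hA.future_map (B x) (B v) (by rw [hB.form_map, h1]) (by rw [hB.form_map, h2])
      (by rwa [hB.form_map]) (hB.future_map x v h1 h2 h3 h4)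

/-- Maps of the quadric that are locally restrictions of isometries. -/
def isometryPregroupoid : Pregroupoid Quadric where
  property f s := ∀ x ∈ s, ∃ A, IsIsometry A ∧
    ∃ u, IsOpen u ∧ x ∈ u ∧ ∀ y ∈ s ∩ u, (f y : E4) = A y
  comp := by
    intro f g u v hf hg _ _ huv x hx
    obtain ⟨A, hA, a, ha, hxa, hfa⟩ := hf x hx.1
    obtain ⟨B, hB, b, hb, hxb, hgb⟩ := hg (f x) hx.2
    have hcont : ContinuousOn f (u ∩ a) := by
      refine Topology.IsInducing.subtypeVal.continuousOn_iff.mpr ?_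
      refine ContinuousOn.congr (f := fun y : Quadric => A (y : E4)) ?_ (fun y hy => hfa y hy)
      exact (A.continuous_of_finiteDimensional.comp continuous_subtype_val).continuousOn
    refine ⟨B.comp A, hB.comp hA, (u ∩ f ⁻¹' v) ∩ a ∩ f ⁻¹' b, ?_, ⟨⟨hx, hxa⟩, hxb⟩, ?_⟩
    · exact (hcont.mono fun y hy => ⟨hy.1.1, hy.2⟩).isOpen_inter_preimage (huv.inter ha) hb
    · rintro y ⟨hy, ⟨-, hya⟩, hyb⟩
      change (g (f y) : E4) = B (A y)
      rw [hgb (f y) ⟨hy.2, hyb⟩, hfa y ⟨hy.1, hya⟩]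
  id_mem := fun _ _ => ⟨_, IsIsometry.id, Set.univ, isOpen_univ, trivial, fun _ _ => rfl⟩
  locality := by
    intro f u _ h x hx
    obtain ⟨v, hv, hxv, hf⟩ := h x hx
    obtain ⟨A, hA, a, ha, hxa, hfa⟩ := hf x ⟨hx, hxv⟩
    exact ⟨A, hA, v ∩ a, hv.inter ha, ⟨hxv, hxa⟩, fun y hy => hfa y ⟨⟨hy.1, hy.2.1⟩, hy.2.2⟩⟩
  congr := by
    intro f g u _ h hf x hx
    obtain ⟨A, hA, a, ha, hxa, hfa⟩ := hf x hx
    exact ⟨A, hA, a, ha, hxa, fun y hy => by rw [h y hy.1, hfa y hy]⟩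

/-- The pseudogroup of local time-orientation preserving isometries. -/
def isometryGroupoid : StructureGroupoid Quadric := isometryPregroupoid.groupoid

/-- A (connected, time-oriented) `AdS₃` manifold: a manifold with an atlas of charts in the quadric,
which is locally isometric to `AdS₃`, whose transition maps are local isometries. -/
class AdSManifold (M : Type*) [TopologicalSpace M] [ChartedSpace Quadric M] : Prop extends
  T2Space M, SecondCountableTopology M, ConnectedSpace M, HasGroupoid M isometryGroupoid

/-- Local isometries (preserving the time orientations) between `AdS₃` manifolds. -/
def IsLocalIsometry {M N : Type*} [TopologicalSpace M] [ChartedSpace Quadric M]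
    [TopologicalSpace N] [ChartedSpace Quadric N] (i : M → N) : Prop :=
  Continuous i ∧ ∀ x, ∃ A, IsIsometry A ∧ ∀ᶠ y in 𝓝 x,
    (chartAt Quadric (i x) (i y) : E4) = A (chartAt Quadric x y : E4)

/-! # Space-like surfaces and their curvature -/

/-- `f`, on the open set `U ⊆ ℝ²`, is a smooth space-like embedding that parametrizes the subset `T`
of the quadric near its point `x = f u`. -/
structure IsParamAt (T : Set Quadric) (x : Quadric) (U : Set E2) (f : E2 → E4) (u : E2) :
    Prop where
  isOpen : IsOpen U
  mem : u ∈ U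
  apply_eq : f u = x
  contDiffOn : ContDiffOn ℝ ∞ f U
  isEmbedding : Topology.IsEmbedding (U.domRestrict f)
  spacelike : ∀ w ∈ U, ∀ v : E2, v ≠ 0 → 0 < form (fderiv ℝ f w v) (fderiv ℝ f w v)
  image_eq : ∃ V : Set Quadric, IsOpen V ∧ x ∈ V ∧ f '' U = Subtype.val '' (T ∩ V)

/-- `T` is an embedded smooth space-like surface (without boundary) in the quadric. -/
def IsSpacelikeSurface (T : Set Quadric) : Prop :=
  ∀ x ∈ T, ∃ U f u, IsParamAt T x U f u

/-- `ν` is the smooth future-directed unit normal field, tangent to the quadric, along the surface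
parametrized by `f` on `U`. -/
structure IsFutureNormal (U : Set E2) (f ν : E2 → E4) : Prop where
  contDiffOn : ContDiffOn ℝ ∞ ν U
  tangent : ∀ w ∈ U, form (f w) (ν w) = 0
  normal : ∀ w ∈ U, ∀ v : E2, form (fderiv ℝ f w v) (ν w) = 0
  unit : ∀ w ∈ U, form (ν w) (ν w) = -1
  future : ∀ w ∈ U, IsFuture (f w) (ν w)

/-- The Levi-Civita covariant derivative in the quadric, at the point `f u` in the direction
`df(v)`, of the vector field `Y` along `f`: the orthogonal projection to the tangent space of the
quadric of the derivative in `ℝ⁴`. -/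
def covDeriv (f Y : E2 → E4) (u v : E2) : E4 :=
  fderiv ℝ Y u v + form (fderiv ℝ Y u v) (f u) • f u

/-- `B` is the shape operator `X ↦ -∇_X ν` at the point `x` of the surface `T`, where `ν` is the
future unit normal field, and where the tangent plane is identified with `ℝ²` by the
differential of a local parametrization `f`. -/
def IsShapeOperatorAt (T : Set Quadric) (x : Quadric) (B : E2 →ₗ[ℝ] E2) : Prop :=
  ∃ U f u ν, IsParamAt T x U f u ∧ IsFutureNormal U f ν ∧
    ∀ v, fderiv ℝ f u (B v) = -covDeriv f ν u v

/-- The surface `T` has mean curvature `H` (half of the trace of the shape operator) at `x`. -/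
def HasMeanCurvatureAt (T : Set Quadric) (x : Quadric) (H : ℝ) : Prop :=
  ∃ B, IsShapeOperatorAt T x B ∧ LinearMap.trace ℝ E2 B / 2 = H

/-- `l₁ ≥ l₂` are the principal curvatures of `T` at `x`: the eigenvalues, with multiplicity, of the
shape operator. -/
def ArePrincipalCurvaturesAt (T : Set Quadric) (x : Quadric) (l₁ l₂ : ℝ) : Prop :=
  l₂ ≤ l₁ ∧ ∃ B, IsShapeOperatorAt T x B ∧
    B.charpoly = (Polynomial.X - Polynomial.C l₁) * (Polynomial.X - Polynomial.C l₂)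

/-- `S` is an embedded space-like surface in `AdS₃` with constant mean curvature `H`. Since `proj` is
a local isometry, the geometry of `S` is that of its preimage in the quadric. -/
def IsHSurface (H : ℝ) (S : Set AdS3) : Prop :=
  IsSpacelikeSurface (proj ⁻¹' S) ∧ ∀ x ∈ proj ⁻¹' S, HasMeanCurvatureAt (proj ⁻¹' S) x H

/-! # Globally hyperbolic maximal compact manifolds -/

section Manifold

variable {M : Type*} [TopologicalSpace M] [ChartedSpace Quadric M]

/-- `F` is an embedded smooth space-like surface (without boundary) in the `AdS₃` manifold `M`. -/
def IsSpacelikeSurfaceIn (F : Set M) : Prop :=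
  ∀ e ∈ atlas Quadric M, IsSpacelikeSurface (e '' (F ∩ e.source))

/-- `γ` is a future-directed causal (non-space-like) regular `C¹` curve. -/
def IsCausalCurve (γ : ℝ → M) : Prop :=
  Continuous γ ∧ ∀ e ∈ atlas Quadric M,
    ContDiffOn ℝ 1 (fun s => (e (γ s) : E4)) (γ ⁻¹' e.source) ∧
    ∀ s ∈ γ ⁻¹' e.source,
      form (deriv (fun s => (e (γ s) : E4)) s) (deriv (fun s => (e (γ s) : E4)) s) ≤ 0 ∧
      IsFuture (e (γ s)) (deriv (fun s => (e (γ s) : E4)) s)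

/-- The curve `γ` has no endpoint in `M`, neither in the future nor in the past. -/
def IsInextendible (γ : ℝ → M) : Prop :=
  ∀ q, ¬ Filter.Tendsto γ Filter.atTop (𝓝 q) ∧ ¬ Filter.Tendsto γ Filter.atBot (𝓝 q)

/-- A Cauchy surface: a space-like surface that every inextendible causal curve meets exactly
once. -/
def IsCauchySurface (F : Set M) : Prop :=
  IsSpacelikeSurfaceIn F ∧ ∀ γ : ℝ → M, IsCausalCurve γ → IsInextendible γ → ∃! t, γ t ∈ F

end Manifold

/-- `M` is globally hyperbolic with a compact Cauchy surface, and maximal with this property: every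
isometric embedding of `M` in an `AdS₃` manifold that sends a Cauchy surface to a Cauchy surface
is onto. -/
structure IsGHMC (M : Type u) [TopologicalSpace M] [ChartedSpace Quadric M] [AdSManifold M] :
    Prop where
  exists_cauchy : ∃ F : Set M, IsCauchySurface F ∧ IsCompact F
  maximal : ∀ (N : Type u) [TopologicalSpace N] [ChartedSpace Quadric N] [AdSManifold N]
    (i : M → N), IsLocalIsometry i → Function.Injective i →
    (∃ F : Set M, IsCauchySurface F ∧ IsCauchySurface (i '' F)) → Function.Surjective i

/-! # Lifts to `AdS₃` -/

/-- `dev` is a developing map, defined on the covering `p : X → M`: it is locally the composition of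
`p`, a chart of `M`, an isometry, and the projection to `AdS₃`. -/
def IsDevelopingMap {M X : Type*} [TopologicalSpace M] [ChartedSpace Quadric M]
    [TopologicalSpace X] (p : X → M) (dev : X → AdS3) : Prop :=
  ∀ x, ∃ A, IsIsometry A ∧ ∀ᶠ y in 𝓝 x, ∃ z : Quadric,
    (z : E4) = A (chartAt Quadric (p x) (p y) : E4) ∧ dev y = proj z

/-- `S ⊆ AdS₃` is a lift of the surface `F ⊆ M`: a developing map of the universal cover of `M`
embeds a connected component of the preimage of `F`, with image `S`. -/
def IsLift {M : Type u} [TopologicalSpace M] [ChartedSpace Quadric M]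
    (F : Set M) (S : Set AdS3) : Prop :=
  ∃ (X : Type u) (_ : TopologicalSpace X) (_ : SimplyConnectedSpace X) (p : X → M)
    (dev : X → AdS3) (x : X), IsCoveringMap p ∧ IsDevelopingMap p dev ∧ x ∈ p ⁻¹' F ∧
    Topology.IsEmbedding ((connectedComponentIn (p ⁻¹' F) x).domRestrict dev) ∧
    S = dev '' connectedComponentIn (p ⁻¹' F) x

end AdS

end

/-!
# Principal curvatures of closed surfaces of constant mean curvature in `AdS₃`

Let `B` be the shape operator and `K = det B`, so that the principal curvatures are
`H ± √(H² - K)`. The bounds amount to `K ≥ -1`, that is, to the non-positivity of the curvature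
`-1 - K` of the surface. This follows from the maximum principle: the function `μ = √(H² - K)`
satisfies `Δ log μ = 2 (-1 - K)` where it does not vanish, because the traceless part of `B` is a
Codazzi tensor, and at a maximum of `μ` the left-hand side is not positive.

The maximum exists because `F` is compact. A component `C` of the preimage of `F` in the covering
has a closed, hence compact, projection to `M` (`isClosed_image_component`); near each point the
lift is the image of `F` under an isometry (`exists_local_structure`), so `K` is the pull-back of a
continuous function on this compact set (`detShape_eq_of_apply_eq`, `exists_min_detShape`).

The differential inequality is only needed at the point where `K` is minimal, where it is a
computation with Taylor expansions. In the Klein model the surface is a graph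
`f = l (1, x, y, Z(x, y))`, tangent to the plane `Z = 0` at the origin, with principal directions
along the axes. The model being projective, the second fundamental form is conformal to the Hessian
of `Z` (`second_form_klein`), and the mean curvature and `K` are explicit in the derivatives of `Z`
of order at most two (`curvature_klein`). Let `a` and `b` be the second derivatives of `Z` along the
axes at the origin. The expansions of both curvatures to order two along the two axes
(`axis_expansion`) show that, if `a ≠ b`, the third derivatives of `Z` vanish, and that the sum of
the two second derivatives of `K` is `(a - b)² (1 + a b)`. As it is not negative, `K = a b ≥ -1`
(`neg_one_le_of_axis_relations`); if `a = b`, this is clear.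

The trace and the determinant of `B` do not depend on the parametrization used to define `B`, as two
parametrizations differ by a diffeomorphism and the future unit normal is unique
(`IsShapeOperatorAt.invariants_eq`).
-/

noncomputable section

namespace AdS

open Filter

/-! ### Second-order expansions of functions of one variable -/

/-- `f` has the expansion `f(t) = a + b t + c t² + o(t²)` at `0`. The value `f 0` plays no role. -/
def Jet (f : ℝ → ℝ) (a b c : ℝ) : Prop :=
  ∃ R : ℝ → ℝ, Tendsto R (𝓝[≠] 0) (𝓝 c) ∧ ∀ᶠ t in 𝓝[≠] 0, f t = a + b * t + t ^ 2 * R t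

theorem tendsto_id_punctured : Tendsto (fun t : ℝ => t) (𝓝[≠] 0) (𝓝 0) :=
  tendsto_nhdsWithin_of_tendsto_nhds tendsto_id

theorem Jet.const (a : ℝ) : Jet (fun _ => a) a 0 0 :=
  ⟨fun _ => 0, tendsto_const_nhds, by simp⟩

theorem Jet.id : Jet (fun t => t) 0 1 0 :=
  ⟨fun _ => 0, tendsto_const_nhds, by simp⟩

theorem Jet.add {f g : ℝ → ℝ} {a b c a' b' c' : ℝ} (hf : Jet f a b c) (hg : Jet g a' b' c') :
    Jet (fun t => f t + g t) (a + a') (b + b') (c + c') := by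
  obtain ⟨R, hR, hf⟩ := hf
  obtain ⟨Q, hQ, hg⟩ := hg
  refine ⟨fun t => R t + Q t, hR.add hQ, ?_⟩
  filter_upwards [hf, hg] with t h1 h2
  rw [h1, h2]; ring

theorem Jet.mul {f g : ℝ → ℝ} {a b c a' b' c' : ℝ} (hf : Jet f a b c) (hg : Jet g a' b' c') :
    Jet (fun t => f t * g t) (a * a') (a * b' + b * a') (a * c' + b * b' + c * a') := by
  obtain ⟨R, hR, hf⟩ := hf
  obtain ⟨Q, hQ, hg⟩ := hg
  refine ⟨fun t => (a * Q t + b * b' + R t * a') + t * (b * Q t + R t * b' + t * (R t * Q t)),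
    ?_, ?_⟩
  · have h1 := ((hQ.const_mul a).add_const (b * b')).add (hR.mul_const a')
    have h2 := tendsto_id_punctured.mul
      (((hQ.const_mul b).add (hR.mul_const b')).add (tendsto_id_punctured.mul (hR.mul hQ)))
    simpa using h1.add h2
  · filter_upwards [hf, hg] with t h1 h2
    rw [h1, h2]; ring

theorem Jet.neg {f : ℝ → ℝ} {a b c : ℝ} (hf : Jet f a b c) :
    Jet (fun t => -f t) (-a) (-b) (-c) := by
  obtain ⟨R, hR, hf⟩ := hf
  refine ⟨fun t => -R t, hR.neg, ?_⟩
  filter_upwards [hf] with t h1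
  rw [h1]; ring

theorem Jet.sub {f g : ℝ → ℝ} {a b c a' b' c' : ℝ} (hf : Jet f a b c) (hg : Jet g a' b' c') :
    Jet (fun t => f t - g t) (a - a') (b - b') (c - c') := by
  simpa [sub_eq_add_neg] using hf.add hg.neg

theorem Jet.pow_two {f : ℝ → ℝ} {a b c : ℝ} (hf : Jet f a b c) :
    Jet (fun t => f t ^ 2) (a ^ 2) (2 * a * b) (2 * a * c + b ^ 2) := by
  have := hf.mul hf
  convert this using 1
  · ext t; ring
  all_goals ring

theorem Jet.congr {f g : ℝ → ℝ} {a b c : ℝ} (hf : Jet f a b c) (h : f =ᶠ[𝓝 0] g) :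
    Jet g a b c := by
  obtain ⟨R, hR, hf⟩ := hf
  refine ⟨R, hR, ?_⟩
  filter_upwards [hf, h.filter_mono nhdsWithin_le_nhds] with t h1 h2
  rw [← h2, h1]

theorem Jet.tendsto {f : ℝ → ℝ} {a b c : ℝ} (hf : Jet f a b c) : Tendsto f (𝓝[≠] 0) (𝓝 a) := by
  obtain ⟨R, hR, hf⟩ := hf
  have h := (tendsto_const_nhds (x := a)).add ((tendsto_id_punctured.const_mul b).add
    ((tendsto_id_punctured.pow 2).mul hR))
  have h' : Tendsto (fun t : ℝ => a + (b * t + t ^ 2 * R t)) (𝓝[≠] 0) (𝓝 a) := by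
    simpa using h
  refine h'.congr' ?_
  filter_upwards [hf] with t ht
  rw [ht]; ring

/-- The slope of an expansion without constant term. -/
theorem Jet.tendsto_div {f : ℝ → ℝ} {b c : ℝ} (hf : Jet f 0 b c) :
    Tendsto (fun t => f t / t) (𝓝[≠] 0) (𝓝 b) := by
  obtain ⟨R, hR, hf⟩ := hf
  have h : Tendsto (fun t : ℝ => b + t * R t) (𝓝[≠] 0) (𝓝 b) := by
    simpa using (tendsto_id_punctured.mul hR).const_add b
  refine h.congr' ?_
  filter_upwards [hf, self_mem_nhdsWithin] with t ht h0
  have : t ≠ 0 := h0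
  rw [ht]; field_simp; ring

theorem Jet.tendsto_div_sq {f : ℝ → ℝ} {c : ℝ} (hf : Jet f 0 0 c) :
    Tendsto (fun t => f t / t ^ 2) (𝓝[≠] 0) (𝓝 c) := by
  obtain ⟨R, hR, hf⟩ := hf
  refine hR.congr' ?_
  filter_upwards [hf, self_mem_nhdsWithin] with t ht h0
  have : t ≠ 0 := h0
  rw [ht]; field_simp; ring

theorem Jet.unique {f : ℝ → ℝ} {a b c a' b' c' : ℝ} (hf : Jet f a b c) (hg : Jet f a' b' c') :
    a = a' ∧ b = b' ∧ c = c' := by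
  have h := hf.sub hg
  have h0 : Tendsto (fun _ : ℝ => (0 : ℝ)) (𝓝[≠] (0 : ℝ)) (𝓝 0) := tendsto_const_nhds
  simp only [sub_self] at h
  have ha : a - a' = 0 := tendsto_nhds_unique h.tendsto h0
  rw [ha] at h
  have hb : b - b' = 0 := tendsto_nhds_unique h.tendsto_div (by simp)
  rw [hb] at h
  have hc : c - c' = 0 := tendsto_nhds_unique h.tendsto_div_sq (by simp)
  exact ⟨sub_eq_zero.1 ha, sub_eq_zero.1 hb, sub_eq_zero.1 hc⟩

/-- The first and second derivative tests at a minimum. -/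
theorem Jet.of_nonneg {f : ℝ → ℝ} {b c : ℝ} (hf : Jet f 0 b c) (h : ∀ᶠ t in 𝓝 0, 0 ≤ f t) :
    b = 0 ∧ 0 ≤ c := by
  have hb : b = 0 := by
    apply le_antisymm
    · have h1 := hf.tendsto_div.mono_left
        (nhdsWithin_mono 0 (fun t (ht : t < 0) => ne_of_lt ht) : 𝓝[<] (0 : ℝ) ≤ 𝓝[≠] 0)
      refine le_of_tendsto h1 ?_
      filter_upwards [h.filter_mono nhdsWithin_le_nhds, self_mem_nhdsWithin] with t ht h0
      exact div_nonpos_of_nonneg_of_nonpos ht (le_of_lt h0)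
    · have h1 := hf.tendsto_div.mono_left
        (nhdsWithin_mono 0 (fun t (ht : 0 < t) => ne_of_gt ht) : 𝓝[>] (0 : ℝ) ≤ 𝓝[≠] 0)
      refine ge_of_tendsto h1 ?_
      filter_upwards [h.filter_mono nhdsWithin_le_nhds, self_mem_nhdsWithin] with t ht h0
      exact div_nonneg ht (le_of_lt h0)
  subst hb
  refine ⟨rfl, ge_of_tendsto hf.tendsto_div_sq ?_⟩
  filter_upwards [h.filter_mono nhdsWithin_le_nhds] with t ht
  positivity

/-- Taylor's formula: a function whose derivative `g` near `0` has derivative `c` at `0`. -/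
theorem Jet.of_hasDerivAt {f g : ℝ → ℝ} {c : ℝ} (hf : ∀ᶠ t in 𝓝 0, HasDerivAt f (g t) t)
    (hg : HasDerivAt g c 0) : Jet f (f 0) (g 0) (c / 2) := by
  refine ⟨fun t => (f t - f 0 - g 0 * t) / t ^ 2, ?_, ?_⟩
  · have hlim : Tendsto (fun t => (g t - g 0) / (2 * t)) (𝓝[≠] 0) (𝓝 (c / 2)) := by
      have h := (hasDerivAt_iff_tendsto_slope.1 hg).div_const 2
      refine h.congr' ?_
      filter_upwards [self_mem_nhdsWithin] with t h0
      have : t ≠ 0 := h0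
      rw [slope_def_field]; field_simp; ring
    refine HasDerivAt.lhopital_zero_nhdsNE (f' := fun t => g t - g 0) (g' := fun t => 2 * t)
      ?_ ?_ ?_ ?_ ?_ hlim
    · filter_upwards [hf.filter_mono nhdsWithin_le_nhds] with t ht
      have : HasDerivAt (fun t => f t - f 0 - g 0 * t) (g t - g 0 * 1) t :=
        (ht.sub_const (f 0)).sub ((hasDerivAt_id t).const_mul (g 0))
      simpa using this
    · exact Eventually.of_forall fun t => by simpa using hasDerivAt_pow 2 t
    · filter_upwards [self_mem_nhdsWithin] with t h0
      have : t ≠ 0 := h0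
      positivity
    · have hc : ContinuousAt f 0 := hf.self_of_nhds.continuousAt
      have h1 : Tendsto f (𝓝[≠] 0) (𝓝 (f 0)) := hc.tendsto.mono_left nhdsWithin_le_nhds
      simpa using (h1.sub_const (f 0)).sub (tendsto_id_punctured.const_mul (g 0))
    · simpa using tendsto_id_punctured.pow 2
  · filter_upwards [self_mem_nhdsWithin] with t h0
    have : t ≠ 0 := h0
    field_simp; ring

/-! ### The curvature equations along an axis -/

/-- The expansions along an axis of the curvature equations of the graph of `Z` in the Klein model.
`A = Z`, `B` and `C` are the first derivatives of `Z` along and across the axis, and `D`, `E`, `G`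
are its second derivatives. The third derivatives at `0` are therefore `2 d₁`, `2 e₁` and `g₁`, and
`b` is the second derivative of `Z` across the axis. The principal curvatures at `0` are `-a` and
`-b`, the trace of the shape operator is the constant `τ`, and its determinant is `κ`, with a
minimum at `0`. -/
theorem axis_expansion {l n A B C D E G κ : ℝ → ℝ} {τ a b d₁ d₂ e₁ e₂ g₁ g₂ l₁ l₂ n₁ n₂ : ℝ}
    (hl : Jet l 1 l₁ l₂) (hn : Jet n 1 n₁ n₂)
    (hA : Jet A 0 0 (a / 2)) (hB : Jet B 0 a d₁) (hC : Jet C 0 0 e₁)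
    (hD : Jet D a (2 * d₁) d₂) (hE : Jet E 0 (2 * e₁) e₂) (hG : Jet G b g₁ g₂)
    (h1 : ∀ᶠ t in 𝓝 0, l t ^ 2 * (1 - t ^ 2 + A t ^ 2) = 1)
    (h2 : ∀ᶠ t in 𝓝 0, n t ^ 2 * (1 + (A t - t * B t) ^ 2 - B t ^ 2 - C t ^ 2) = 1)
    (h3 : ∀ᶠ t in 𝓝 0, τ * l t * (1 + (A t - t * B t) ^ 2 - B t ^ 2 - C t ^ 2) =
      -n t * (((1 - t ^ 2 + A t ^ 2) * (1 - C t ^ 2) + (A t * C t) ^ 2) * D t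
        + 2 * ((1 - t ^ 2 + A t ^ 2) * (B t * C t) + (t - A t * B t) * (A t * C t)) * E t
        + ((1 - t ^ 2 + A t ^ 2) * (1 - B t ^ 2) + (t - A t * B t) ^ 2) * G t))
    (h4 : ∀ᶠ t in 𝓝 0, κ t * ((1 + (A t - t * B t) ^ 2 - B t ^ 2 - C t ^ 2) ^ 2 * (l t ^ 2) ^ 2) =
      D t * G t - E t ^ 2)
    (hκ : ∀ᶠ t in 𝓝 0, a * b ≤ κ t) :
    τ = -(a + b) ∧ 2 * d₁ + g₁ = 0 ∧ a * g₁ + 2 * b * d₁ = 0 ∧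
    d₂ + g₂ = a + a ^ 2 * b - (a + b) * a ^ 2 / 2 - (a + b) * (a ^ 2 - 1 / 2) ∧
    0 ≤ a * g₂ + b * d₂ + 2 * d₁ * g₁ - 4 * e₁ ^ 2 - a * b * (2 - 2 * a ^ 2) := by
  have hL := ((Jet.const 1).sub Jet.id.pow_two).add hA.pow_two
  have hDl := (((Jet.const 1).add (hA.sub (Jet.id.mul hB)).pow_two).sub hB.pow_two).sub hC.pow_two
  have e1 := ((hl.pow_two.mul hL).congr h1).unique (Jet.const 1)
  have e2 := ((hn.pow_two.mul hDl).congr h2).unique (Jet.const 1)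
  have hP := Jet.id.sub (hA.mul hB)
  have hR := hn.neg.mul ((((hL.mul ((Jet.const 1).sub hC.pow_two)).add (hA.mul hC).pow_two).mul
    hD).add ((((Jet.const 2).mul ((hL.mul (hB.mul hC)).add (hP.mul (hA.mul hC)))).mul hE)) |>.add
    (((hL.mul ((Jet.const 1).sub hB.pow_two)).add hP.pow_two).mul hG))
  have e3 := ((((Jet.const τ).mul hl).mul hDl).congr h3).unique hR
  have hQ := hDl.pow_two.mul hl.pow_two.pow_two
  have hM := (((hD.mul hG).sub hE.pow_two).sub ((Jet.const (a * b)).mul hQ))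
  ring_nf at e1 e2 e3
  obtain ⟨-, e11, e12⟩ := e1
  obtain ⟨-, e21, e22⟩ := e2
  have hl1 : l₁ = 0 := by linarith
  have hn1 : n₁ = 0 := by linarith
  subst hl1 hn1
  have hl2 : l₂ = 1 / 2 := by linarith
  have hn2 : n₂ = a ^ 2 / 2 := by linarith
  subst hl2 hn2
  obtain ⟨e31, e32, e33⟩ := e3
  have hτ : τ = -(a + b) := by linarith
  have hM' : Jet (fun t => D t * G t - E t ^ 2 - a * b *
      ((1 + (A t - t * B t) ^ 2 - B t ^ 2 - C t ^ 2) ^ 2 * (l t ^ 2) ^ 2)) 0 (a * g₁ + 2 * b * d₁)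
      (a * g₂ + b * d₂ + 2 * d₁ * g₁ - 4 * e₁ ^ 2 - a * b * (2 - 2 * a ^ 2)) := by
    convert hM using 1 <;> ring
  -- The minimum of `κ` is read off `κ - a b`, multiplied by a positive factor.
  have hpos := hM'.of_nonneg (by
    filter_upwards [h4, hκ] with t ht hk
    rw [← ht, ← sub_mul]
    exact mul_nonneg (sub_nonneg.2 hk) (by positivity))
  refine ⟨hτ, by linarith, hpos.1, ?_, hpos.2⟩
  subst hτ
  linarith

/-- If the curvature equations hold along both axes, then `κ = a b ≥ -1` at the minimum. -/
theorem neg_one_le_of_axis_relations {a b d₁ d₂ g₁ g₂ d₁' d₂' g₁' : ℝ}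
    (h1 : 2 * d₁ + g₁ = 0) (h2 : a * g₁ + 2 * b * d₁ = 0)
    (h3 : d₂ + g₂ = a + a ^ 2 * b - (a + b) * a ^ 2 / 2 - (a + b) * (a ^ 2 - 1 / 2))
    (h4 : 0 ≤ a * g₂ + b * d₂ + 2 * d₁ * g₁ - g₁' ^ 2 - a * b * (2 - 2 * a ^ 2))
    (h1' : 2 * d₁' + g₁' = 0) (h2' : b * g₁' + 2 * a * d₁' = 0)
    (h3' : d₂' + g₂ = b + b ^ 2 * a - (b + a) * b ^ 2 / 2 - (b + a) * (b ^ 2 - 1 / 2))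
    (h4' : 0 ≤ b * g₂ + a * d₂' + 2 * d₁' * g₁' - g₁ ^ 2 - b * a * (2 - 2 * b ^ 2)) :
    -1 ≤ a * b := by
  by_cases hab : a = b
  · subst hab; nlinarith [sq_nonneg a]
  have hab' : a - b ≠ 0 := sub_ne_zero.2 hab
  have hg : g₁ = 0 := by
    have : (a - b) * g₁ = 0 := by linear_combination h2 - b * h1
    exact (mul_eq_zero.1 this).resolve_left hab'
  have hg' : g₁' = 0 := by
    have : (a - b) * g₁' = 0 := by linear_combination a * h1' - h2'
    exact (mul_eq_zero.1 this).resolve_left hab'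
  subst hg hg'
  have hd : d₂ = a + a ^ 2 * b - (a + b) * a ^ 2 / 2 - (a + b) * (a ^ 2 - 1 / 2) - g₂ := by
    linarith
  have hd' : d₂' = b + b ^ 2 * a - (b + a) * b ^ 2 / 2 - (b + a) * (b ^ 2 - 1 / 2) - g₂ := by
    linarith
  subst hd hd'
  -- Without the third derivatives, the right-hand sides of `h4` and `h4'` add up to
  -- `(a - b)² (1 + a b) / 2`.
  have key : 0 ≤ (a - b) ^ 2 * (1 + a * b) := by linarith
  have hp : 0 < (a - b) ^ 2 := by positivity
  have := nonneg_of_mul_nonneg_right key hp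
  linarith

/-! ### Linear algebra of the form of signature `(2,2)` -/

theorem form_comm (x y : E4) : form x y = form y x := by simp only [form]; ring

theorem form_add_left (x y z : E4) : form (x + y) z = form x z + form y z := by
  simp only [form, Pi.add_apply]; ring

theorem form_smul_left (c : ℝ) (x y : E4) : form (c • x) y = c * form x y := by
  simp only [form, Pi.smul_apply, smul_eq_mul]; ring

theorem form_add_right (x y z : E4) : form x (y + z) = form x y + form x z := by
  simp only [form, Pi.add_apply]; ring

theorem form_smul_right (c : ℝ) (x y : E4) : form x (c • y) = c * form x y := by
  simp only [form, Pi.smul_apply, smul_eq_mul]; ring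

theorem form_neg_left (x y : E4) : form (-x) y = -form x y := by
  simp only [form, Pi.neg_apply]; ring

theorem form_neg_right (x y : E4) : form x (-y) = -form x y := by
  simp only [form, Pi.neg_apply]; ring

theorem form_zero_left (y : E4) : form 0 y = 0 := by simp [form]

/-- The form as a continuous bilinear map. -/
def formL : E4 →L[ℝ] E4 →L[ℝ] ℝ :=
  (LinearMap.mk₂ ℝ form form_add_left form_smul_left form_add_right
    form_smul_right).toContinuousBilinearMap

theorem formL_apply (x y : E4) : formL x y = form x y := rfl

theorem continuous_form : Continuous fun p : E4 × E4 => form p.1 p.2 := by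
  unfold form; fun_prop

theorem eq_zero_of_forall_form {x : E4} (h : ∀ y, form x y = 0) : x = 0 := by
  ext i
  have := h (Pi.single i 1)
  fin_cases i <;> simpa [form, Pi.single_apply] using this

/-- A point `x` of the quadric, a space-like plane tangent at `x` and a unit normal vector span
`ℝ⁴`. -/
theorem exists_expansion {x n : E4} {L : E2 →ₗ[ℝ] E4} (hx : form x x = -1)
    (hxL : ∀ v, form x (L v) = 0) (hL : ∀ v, v ≠ 0 → 0 < form (L v) (L v))
    (hxn : form x n = 0) (hLn : ∀ v, form (L v) n = 0) (hn : form n n = -1) (y : E4) :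
    ∃ (a c : ℝ) (v : E2), y = a • x + L v + c • n := by
  let Φ : (ℝ × E2 × ℝ) →ₗ[ℝ] E4 :=
    (LinearMap.toSpanSingleton ℝ E4 x).coprod (L.coprod (LinearMap.toSpanSingleton ℝ E4 n))
  have hΦ : ∀ q, Φ q = q.1 • x + (L q.2.1 + q.2.2 • n) := fun q => by simp [Φ]
  have hinj : Function.Injective Φ := by
    rw [← LinearMap.ker_eq_bot, LinearMap.ker_eq_bot']
    rintro ⟨a, v, c⟩ h
    rw [hΦ] at h
    dsimp only at h
    have h1 := congrArg (form x) h
    have h2 := congrArg (form n) h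
    have h3 := congrArg (form (L v)) h
    simp only [form_add_right, form_smul_right, hx, hxL, hxn, form_comm n x, form_comm n (L v),
      hLn, hn, form_comm (L v) x, form_comm _ (0 : E4), form_zero_left] at h1 h2 h3
    have hv : v = 0 := by
      by_contra hv
      have := hL v hv
      linarith
    have ha : a = 0 := by linarith
    have hc : c = 0 := by linarith
    rw [ha, hv, hc]; rfl
  have hs := (LinearMap.injective_iff_surjective_of_finrank_eq_finrank (by simp)).1 hinj
  obtain ⟨⟨a, v, c⟩, h⟩ := hs y
  rw [hΦ] at h
  exact ⟨a, c, v, by rw [← h, add_assoc]⟩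

/-- The future unit normal vector of a space-like plane is unique. -/
theorem normal_unique {x n n' : E4} {L : E2 →ₗ[ℝ] E4} (hx : form x x = -1)
    (hxL : ∀ v, form x (L v) = 0) (hL : ∀ v, v ≠ 0 → 0 < form (L v) (L v))
    (hxn : form x n = 0) (hLn : ∀ v, form (L v) n = 0) (hn : form n n = -1) (hf : IsFuture x n)
    (hxn' : form x n' = 0) (hLn' : ∀ v, form (L v) n' = 0) (hn' : form n' n' = -1)
    (hf' : IsFuture x n') : n = n' := by
  obtain ⟨a, c, v, h⟩ := exists_expansion hx hxL hL hxn hLn hn n'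
  have h1 := congrArg (form x) h
  have h3 := congrArg (form (L v)) h
  simp only [form_add_right, form_smul_right, hx, hxL, hxn, hxn', hLn', hLn,
    form_comm (L v) x] at h1 h3
  have hv : v = 0 := by
    by_contra hv
    have := hL v hv
    linarith
  have ha : a = 0 := by linarith
  subst hv ha
  simp only [zero_smul, map_zero, zero_add] at h
  subst h
  simp only [form_smul_left, form_smul_right, hn] at hn'
  simp only [IsFuture, form_smul_left] at hf hf'
  have hc : 0 < c := by
    by_contra hc
    nlinarith
  have : c = 1 := by nlinarith
  rw [this, one_smul]

/-- A time-like vector tangent to the quadric is transverse to the orthogonal complement of the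
time orientation. -/
theorem form_timeField_ne_zero {x v : E4} (hx : form x x = -1) (hxv : form x v = 0)
    (hv : form v v < 0) : form v (timeField x) ≠ 0 := by
  intro h
  simp only [form, timeField, Matrix.cons_val_zero, Matrix.cons_val_one, Matrix.cons_val] at *
  -- The time-like parts of `x` and `v` are proportional, with quotient `c`.
  set r := x 0 ^ 2 + x 3 ^ 2 with hr
  have hr1 : r = 1 + x 1 ^ 2 + x 2 ^ 2 := by rw [hr]; linarith
  have e1 : r * (v 0 ^ 2 + v 3 ^ 2) = (x 1 * v 1 + x 2 * v 2) ^ 2 := by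
    have h3 : x 1 * v 1 + x 2 * v 2 = x 0 * v 0 + x 3 * v 3 := by linarith
    have h4 : x 3 * v 0 - x 0 * v 3 = 0 := by linarith
    rw [h3, hr]
    linear_combination (x 3 * v 0 - x 0 * v 3) * h4
  have hrpos : 0 < r := by rw [hr1]; positivity
  have e2 : r * (v 0 ^ 2 + v 3 ^ 2) ≤ r * (v 1 ^ 2 + v 2 ^ 2) := by
    rw [e1, hr1]
    nlinarith [sq_nonneg (x 1 * v 2 - x 2 * v 1), sq_nonneg (v 1), sq_nonneg (v 2)]
  have := le_of_mul_le_mul_left e2 hrpos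
  linarith

/-! ### Self-adjoint endomorphisms of a Euclidean plane -/

/-- A self-adjoint endomorphism of a plane with a positive definite form has an orthonormal basis
of eigenvectors. -/
theorem exists_orthonormal_eigenvectors (g : LinearMap.BilinForm ℝ E2)
    (hsymm : ∀ v w, g v w = g w v) (hpos : ∀ v, v ≠ 0 → 0 < g v v) (B : E2 →ₗ[ℝ] E2)
    (hB : ∀ v w, g (B v) w = g v (B w)) :
    ∃ (v₁ v₂ : E2) (a b : ℝ), g v₁ v₁ = 1 ∧ g v₂ v₂ = 1 ∧ g v₁ v₂ = 0 ∧
      B v₁ = a • v₁ ∧ B v₂ = b • v₂ := by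
  obtain ⟨u₁, u₂, h11, h22, h12⟩ : ∃ u₁ u₂ : E2, g u₁ u₁ = 1 ∧ g u₂ u₂ = 1 ∧ g u₁ u₂ = 0 := by
    set e : E2 := ![1, 0] with he
    set e' : E2 := ![0, 1] with he'
    have hα : 0 < g e e := hpos e (by intro h; simpa [he] using congrFun h 0)
    set w := e' - (g e e' / g e e) • e with hw
    have hβ : 0 < g w w := hpos w (by intro h; simpa [hw, he, he'] using congrFun h 1)
    have hew : g e w = 0 := by
      rw [hw]; simp only [map_sub, map_smul, smul_eq_mul]; field_simp; ring
    refine ⟨(√(g e e))⁻¹ • e, (√(g w w))⁻¹ • w, ?_, ?_, ?_⟩ <;>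
      simp only [map_smul, LinearMap.smul_apply, smul_eq_mul, hew, mul_zero]
    · rw [← mul_assoc, ← mul_inv, Real.mul_self_sqrt hα.le, inv_mul_cancel₀ hα.ne']
    · rw [← mul_assoc, ← mul_inv, Real.mul_self_sqrt hβ.le, inv_mul_cancel₀ hβ.ne']
  -- The angle of the rotation that makes `B` diagonal is half the argument of `z`.
  set z : ℂ := ⟨g (B u₁) u₁ - g (B u₂) u₂, 2 * g (B u₁) u₂⟩ with hz
  set θ := z.arg / 2 with hθ
  have hre : g (B u₁) u₁ - g (B u₂) u₂ = ‖z‖ * Real.cos (2 * θ) := by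
    rw [hθ, mul_div_cancel₀ _ two_ne_zero, Complex.norm_mul_cos_arg]
  have him : 2 * g (B u₁) u₂ = ‖z‖ * Real.sin (2 * θ) := by
    rw [hθ, mul_div_cancel₀ _ two_ne_zero, Complex.norm_mul_sin_arg]
  set v₁ := Real.cos θ • u₁ + Real.sin θ • u₂ with hv₁
  set v₂ := -Real.sin θ • u₁ + Real.cos θ • u₂ with hv₂
  have hcs := Real.sin_sq_add_cos_sq θ
  have h21 : g u₂ u₁ = 0 := by rw [hsymm, h12]
  have k11 : g v₁ v₁ = 1 := by
    simp only [hv₁, map_add, map_smul, LinearMap.add_apply, LinearMap.smul_apply, smul_eq_mul,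
      h11, h22, h12, h21]
    linarith
  have k22 : g v₂ v₂ = 1 := by
    simp only [hv₂, map_add, map_smul, LinearMap.add_apply, LinearMap.smul_apply, smul_eq_mul,
      h11, h22, h12, h21]
    linarith
  have k12 : g v₁ v₂ = 0 := by
    simp only [hv₁, hv₂, map_add, map_smul, LinearMap.add_apply, LinearMap.smul_apply,
      smul_eq_mul, h11, h22, h12, h21]
    ring
  have kB : g (B v₁) v₂ = 0 := by
    have hs : g (B u₂) u₁ = g (B u₁) u₂ := by rw [hB, hsymm]
    simp only [hv₁, hv₂, map_add, map_smul, LinearMap.add_apply, LinearMap.smul_apply,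
      smul_eq_mul, hs]
    rw [Real.cos_two_mul] at hre
    rw [Real.sin_two_mul] at him
    linear_combination (-Real.sin θ * Real.cos θ) * hre +
      ((Real.cos θ ^ 2 - Real.sin θ ^ 2) / 2) * him -
        (‖z‖ * Real.sin θ * Real.cos θ) * hcs
  have hli : LinearIndependent ℝ ![v₁, v₂] := by
    rw [LinearIndependent.pair_iff]
    intro s t h
    have h1 := congrArg (g v₁) h
    have h2 := congrArg (g v₂) h
    simp only [map_add, map_smul, smul_eq_mul, k11, k22, k12, hsymm v₂ v₁, map_zero] at h1 h2
    exact ⟨by linarith, by linarith⟩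
  have hexp : ∀ x, x = g x v₁ • v₁ + g x v₂ • v₂ := by
    intro x
    have hspan := hli.span_eq_top_of_card_eq_finrank' (by simp)
    have hx : x ∈ Submodule.span ℝ (Set.range ![v₁, v₂]) := by rw [hspan]; trivial
    simp only [Matrix.range_cons, Matrix.range_empty, Set.union_empty, Set.singleton_union] at hx
    obtain ⟨s, t, rfl⟩ := Submodule.mem_span_pair.1 hx
    simp only [map_add, map_smul, LinearMap.add_apply, LinearMap.smul_apply, smul_eq_mul, k11, k22,
      k12, hsymm v₂ v₁, mul_one, mul_zero, add_zero, zero_add]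
  refine ⟨v₁, v₂, g (B v₁) v₁, g (B v₂) v₂, k11, k22, k12, ?_, ?_⟩
  · conv_lhs => rw [hexp (B v₁), kB, zero_smul, add_zero]
  · have : g (B v₂) v₁ = 0 := by rw [hB, hsymm, kB]
    conv_lhs => rw [hexp (B v₂), this, zero_smul, zero_add]

/-- The characteristic polynomial, the trace and the determinant of a diagonalizable endomorphism
of the plane. -/
theorem charpoly_trace_det_of_eigenvectors {v₁ v₂ : E2} (hli : LinearIndependent ℝ ![v₁, v₂])
    {B : E2 →ₗ[ℝ] E2} {a b : ℝ} (h₁ : B v₁ = a • v₁) (h₂ : B v₂ = b • v₂) :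
    B.charpoly = (Polynomial.X - Polynomial.C a) * (Polynomial.X - Polynomial.C b) ∧
      LinearMap.trace ℝ E2 B = a + b ∧ LinearMap.det B = a * b := by
  let β := basisOfLinearIndependentOfCardEqFinrank hli (by simp)
  have hβ0 : β 0 = v₁ := by simp [β]
  have hβ1 : β 1 = v₂ := by simp [β]
  have hM : LinearMap.toMatrix β β B = Matrix.diagonal ![a, b] := by
    ext i j
    rw [LinearMap.toMatrix_apply]
    fin_cases j
    · simp only [Fin.zero_eta, hβ0, h₁, map_smul]
      rw [← hβ0]
      fin_cases i <;> simp
    · simp only [Fin.mk_one, hβ1, h₂, map_smul]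
      rw [← hβ1]
      fin_cases i <;> simp
  refine ⟨?_, ?_, ?_⟩
  · rw [← LinearMap.charpoly_toMatrix B β, hM, Matrix.charpoly_diagonal]
    simp [Fin.prod_univ_two]
  · rw [LinearMap.trace_eq_matrix_trace ℝ β B, hM, Matrix.trace_diagonal]
    simp [Fin.sum_univ_two]
  · rw [← LinearMap.det_toMatrix β B, hM, Matrix.det_diagonal]
    simp [Fin.prod_univ_two]

/-- The trace and the determinant as the coefficients of a split characteristic polynomial. -/
theorem trace_det_of_charpoly {B : E2 →ₗ[ℝ] E2} {a b : ℝ}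
    (h : B.charpoly = (Polynomial.X - Polynomial.C a) * (Polynomial.X - Polynomial.C b)) :
    LinearMap.trace ℝ E2 B = a + b ∧ LinearMap.det B = a * b := by
  have h' : B.charpoly = Polynomial.X ^ 2 - Polynomial.C (LinearMap.trace ℝ E2 B) * Polynomial.X
      + Polynomial.C (LinearMap.det B) := by
    rw [← LinearMap.charpoly_toMatrix B (Pi.basisFun ℝ (Fin 2)), Matrix.charpoly_fin_two,
      LinearMap.det_toMatrix, LinearMap.trace_eq_matrix_trace ℝ (Pi.basisFun ℝ (Fin 2)) B]
  rw [h'] at h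
  have h0 := congrArg (Polynomial.eval 0) h
  have h1 := congrArg (Polynomial.eval 1) h
  simp at h0 h1
  exact ⟨by linarith, by linarith⟩

/-! ### Surfaces with a unit normal field -/

theorem hasFDerivAt_form {f g : E2 → E4} {f' g' : E2 →L[ℝ] E4} {w : E2} (hf : HasFDerivAt f f' w)
    (hg : HasFDerivAt g g' w) :
    ∃ h' : E2 →L[ℝ] ℝ, HasFDerivAt (fun y => form (f y) (g y)) h' w ∧
      ∀ v, h' v = form (f' v) (g w) + form (f w) (g' v) :=
  ⟨_, formL.hasFDerivAt_of_bilinear hf hg, fun v => by simp [formL_apply, add_comm]⟩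

/-- Leibniz' rule for two vector fields with constant product. -/
theorem form_fderiv_add_eq_zero {f g : E2 → E4} {w : E2} {c : ℝ} (hf : DifferentiableAt ℝ f w)
    (hg : DifferentiableAt ℝ g w) (h : ∀ᶠ y in 𝓝 w, form (f y) (g y) = c) (v : E2) :
    form (fderiv ℝ f w v) (g w) + form (f w) (fderiv ℝ g w v) = 0 := by
  obtain ⟨h', hh, hv⟩ := hasFDerivAt_form hf.hasFDerivAt hg.hasFDerivAt
  rw [← hv, hh.unique ((hasFDerivAt_const c w).congr_of_eventuallyEq h)]
  rfl

/-- The relation `df ∘ B = -∇ν` that defines the shape operator at `u`. -/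
def ShapeRel (f ν : E2 → E4) (u : E2) (B : E2 →ₗ[ℝ] E2) : Prop :=
  ∀ v, fderiv ℝ f u (B v) = -covDeriv f ν u v

/-- `f` is a space-like immersion of class `Cⁿ` of the open set `U` into the quadric, with unit
normal field `ν` of class `Cⁿ`. -/
structure NormalPair (n : WithTop ℕ∞) (U : Set E2) (f ν : E2 → E4) : Prop where
  isOpen : IsOpen U
  contDiffOn : ContDiffOn ℝ n f U
  contDiffOn_normal : ContDiffOn ℝ n ν U
  quadric : ∀ w ∈ U, form (f w) (f w) = -1
  spacelike : ∀ w ∈ U, ∀ v : E2, v ≠ 0 → 0 < form (fderiv ℝ f w v) (fderiv ℝ f w v)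
  tangent : ∀ w ∈ U, form (f w) (ν w) = 0
  normal : ∀ w ∈ U, ∀ v : E2, form (fderiv ℝ f w v) (ν w) = 0
  unit : ∀ w ∈ U, form (ν w) (ν w) = -1

theorem IsParamAt.quadric {T : Set Quadric} {x : Quadric} {U : Set E2} {f : E2 → E4} {u : E2}
    (h : IsParamAt T x U f u) {w : E2} (hw : w ∈ U) : form (f w) (f w) = -1 := by
  obtain ⟨V, -, -, hV⟩ := h.image_eq
  obtain ⟨z, -, hz⟩ : f w ∈ Subtype.val '' (T ∩ V) := hV ▸ ⟨w, hw, rfl⟩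
  rw [← hz]; exact z.2

theorem IsParamAt.normalPair {T : Set Quadric} {x : Quadric} {U : Set E2} {f ν : E2 → E4} {u : E2}
    (h : IsParamAt T x U f u) (hν : IsFutureNormal U f ν) : NormalPair ∞ U f ν :=
  ⟨h.isOpen, h.contDiffOn, hν.contDiffOn, fun _ => h.quadric, h.spacelike, hν.tangent, hν.normal,
    hν.unit⟩

namespace NormalPair

variable {n : WithTop ℕ∞} {U : Set E2} {f ν : E2 → E4} {w : E2}

theorem contDiffAt (h : NormalPair n U f ν) (hw : w ∈ U) : ContDiffAt ℝ n f w :=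
  h.contDiffOn.contDiffAt (h.isOpen.mem_nhds hw)

theorem contDiffAt_normal (h : NormalPair n U f ν) (hw : w ∈ U) : ContDiffAt ℝ n ν w :=
  h.contDiffOn_normal.contDiffAt (h.isOpen.mem_nhds hw)

theorem differentiableAt (h : NormalPair n U f ν) (hn : n ≠ 0) (hw : w ∈ U) :
    DifferentiableAt ℝ f w := (h.contDiffAt hw).differentiableAt hn

theorem differentiableAt_normal (h : NormalPair n U f ν) (hn : n ≠ 0) (hw : w ∈ U) :
    DifferentiableAt ℝ ν w := (h.contDiffAt_normal hw).differentiableAt hn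

theorem form_fderiv (h : NormalPair n U f ν) (hn : n ≠ 0) (hw : w ∈ U) (v : E2) :
    form (f w) (fderiv ℝ f w v) = 0 := by
  have hd := h.differentiableAt hn hw
  have := form_fderiv_add_eq_zero hd hd
    (eventually_of_mem (h.isOpen.mem_nhds hw) h.quadric) v
  rw [form_comm (fderiv ℝ f w v)] at this
  linarith

/-- The second fundamental form `-⟨dν(v), df(v')⟩` is symmetric. -/
theorem form_fderiv_normal_comm (h : NormalPair n U f ν) (hn : 2 ≤ n) (hw : w ∈ U) (v v' : E2) :
    form (fderiv ℝ ν w v) (fderiv ℝ f w v') = form (fderiv ℝ ν w v') (fderiv ℝ f w v) := by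
  have hn0 : n ≠ 0 := (lt_of_lt_of_le (by norm_num) hn).ne'
  have hfd : DifferentiableAt ℝ (fderiv ℝ f) w :=
    ((h.contDiffAt hw).fderiv_right (m := 1) (by rwa [one_add_one_eq_two])).differentiableAt
      one_ne_zero
  have key : ∀ v v', form (fderiv ℝ (fderiv ℝ f) w v v') (ν w) +
      form (fderiv ℝ f w v') (fderiv ℝ ν w v) = 0 := by
    intro v v'
    have h1 : HasFDerivAt (fun y => fderiv ℝ f y v') ((fderiv ℝ (fderiv ℝ f) w).flip v') w := by
      simpa using hfd.hasFDerivAt.clm_apply (hasFDerivAt_const v' w)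
    have := form_fderiv_add_eq_zero h1.differentiableAt (h.differentiableAt_normal hn0 hw)
      (eventually_of_mem (h.isOpen.mem_nhds hw) fun y hy => h.normal y hy v') v
    rwa [h1.fderiv] at this
  have hs : fderiv ℝ (fderiv ℝ f) w v v' = fderiv ℝ (fderiv ℝ f) w v' v :=
    (h.contDiffAt hw).isSymmSndFDerivAt (by simpa using hn) v v'
  have h1 := key v v'
  have h2 := key v' v
  rw [hs] at h1
  rw [form_comm (fderiv ℝ ν w v), form_comm (fderiv ℝ ν w v')]
  linarith

theorem form_shape (h : NormalPair n U f ν) (hn : n ≠ 0) (hw : w ∈ U) {B : E2 →ₗ[ℝ] E2}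
    (hB : ShapeRel f ν w B) (v v' : E2) :
    form (fderiv ℝ f w (B v)) (fderiv ℝ f w v') = -form (fderiv ℝ ν w v) (fderiv ℝ f w v') := by
  rw [hB v, covDeriv, form_neg_left, form_add_left, form_smul_left, h.form_fderiv hn hw]
  ring

/-- The principal directions: an orthonormal basis of eigenvectors of the shape operator. -/
theorem exists_principal_directions (h : NormalPair n U f ν) (hn : 2 ≤ n) (hw : w ∈ U)
    {B : E2 →ₗ[ℝ] E2} (hB : ShapeRel f ν w B) :
    ∃ (v₁ v₂ : E2) (a b : ℝ), form (fderiv ℝ f w v₁) (fderiv ℝ f w v₁) = 1 ∧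
      form (fderiv ℝ f w v₂) (fderiv ℝ f w v₂) = 1 ∧
      form (fderiv ℝ f w v₁) (fderiv ℝ f w v₂) = 0 ∧ B v₁ = a • v₁ ∧ B v₂ = b • v₂ := by
  have hn0 : n ≠ 0 := (lt_of_lt_of_le (by norm_num) hn).ne'
  let g : LinearMap.BilinForm ℝ E2 :=
    LinearMap.mk₂ ℝ (fun v v' => form (fderiv ℝ f w v) (fderiv ℝ f w v'))
      (fun _ _ _ => by rw [map_add, form_add_left])
      (fun _ _ _ => by rw [map_smul, form_smul_left, smul_eq_mul])
      (fun _ _ _ => by rw [map_add, form_add_right])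
      (fun _ _ _ => by rw [map_smul, form_smul_right, smul_eq_mul])
  have hg : ∀ v v', g v v' = form (fderiv ℝ f w v) (fderiv ℝ f w v') := fun _ _ => rfl
  refine exists_orthonormal_eigenvectors g (fun v v' => ?_) (fun v hv => ?_) B (fun v v' => ?_)
  · rw [hg, hg, form_comm]
  · exact h.spacelike w hw v hv
  · rw [hg, hg, h.form_shape hn0 hw hB, form_comm _ (fderiv ℝ f w (B v')),
      h.form_shape hn0 hw hB, h.form_fderiv_normal_comm hn hw]

theorem linearIndependent_of_orthonormal {v₁ v₂ : E2}
    (h₁ : form (fderiv ℝ f w v₁) (fderiv ℝ f w v₁) = 1)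
    (h₂ : form (fderiv ℝ f w v₂) (fderiv ℝ f w v₂) = 1)
    (h₁₂ : form (fderiv ℝ f w v₁) (fderiv ℝ f w v₂) = 0) : LinearIndependent ℝ ![v₁, v₂] := by
  rw [LinearIndependent.pair_iff]
  intro s t hst
  have h0 := congrArg (fderiv ℝ f w) hst
  have e1 := congrArg (form (fderiv ℝ f w v₁)) h0
  have e2 := congrArg (form (fderiv ℝ f w v₂)) h0
  simp only [map_add, map_smul, map_zero, form_add_right, form_smul_right, h₁, h₂, h₁₂,
    form_comm (fderiv ℝ f w v₂) (fderiv ℝ f w v₁), form_comm _ (0 : E4), form_zero_left] at e1 e2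
  exact ⟨by linarith, by linarith⟩

/-- The shape operator has real principal curvatures. -/
theorem exists_charpoly_eq (h : NormalPair n U f ν) (hn : 2 ≤ n) (hw : w ∈ U)
    {B : E2 →ₗ[ℝ] E2} (hB : ShapeRel f ν w B) : ∃ a b : ℝ, b ≤ a ∧
      B.charpoly = (Polynomial.X - Polynomial.C a) * (Polynomial.X - Polynomial.C b) := by
  obtain ⟨v₁, v₂, a, b, h1, h2, h12, hB1, hB2⟩ := h.exists_principal_directions hn hw hB
  have hc := (charpoly_trace_det_of_eigenvectors (linearIndependent_of_orthonormal h1 h2 h12)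
    hB1 hB2).1
  rcases le_total b a with hab | hab
  · exact ⟨a, b, hab, hc⟩
  · exact ⟨b, a, hab, by rw [hc, mul_comm]⟩

end NormalPair

/-! ### Change of parameters -/

theorem ShapeRel.congr {f ν g μ : E2 → E4} {u : E2} {B : E2 →ₗ[ℝ] E2} (h : ShapeRel f ν u B)
    (hf : f =ᶠ[𝓝 u] g) (hν : ν =ᶠ[𝓝 u] μ) : ShapeRel g μ u B := by
  intro v
  have := h v
  rwa [covDeriv, hf.fderiv_eq, hν.fderiv_eq, hf.self_of_nhds] at this

/-- Shape operators are conjugate under a change of parameters. -/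
theorem ShapeRel.comp {f ν : E2 → E4} {φ : E2 → E2} {u : E2} {B : E2 →ₗ[ℝ] E2} {L : E2 ≃ₗ[ℝ] E2}
    (h : ShapeRel f ν (φ u) B) (hf : DifferentiableAt ℝ f (φ u))
    (hν : DifferentiableAt ℝ ν (φ u)) (hφ : DifferentiableAt ℝ φ u)
    (hL : ∀ v, fderiv ℝ φ u v = L v) :
    ShapeRel (f ∘ φ) (ν ∘ φ) u (L.symm.conj B) := by
  intro v
  have := h (L v)
  rw [covDeriv, fderiv_comp u hν hφ, fderiv_comp u hf hφ]
  simp only [ContinuousLinearMap.comp_apply, hL, LinearEquiv.conj_apply_apply,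
    LinearEquiv.apply_symm_apply, LinearEquiv.symm_symm]
  exact this

/-- Two local parametrizations of a surface near a point differ by a change of parameters. -/
theorem IsParamAt.exists_transition {T : Set Quadric} {x : Quadric} {U U' : Set E2}
    {f g : E2 → E4} {u u' : E2} (hf : IsParamAt T x U f u) (hg : IsParamAt T x U' g u') :
    ∃ φ : E2 → E2, ContDiffAt ℝ 1 φ u ∧ φ u = u' ∧ f =ᶠ[𝓝 u] g ∘ φ := by
  have hgd : ContDiffAt ℝ 1 g u' :=
    (hg.contDiffOn.contDiffAt (hg.isOpen.mem_nhds hg.mem)).of_le (by simp)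
  have hfd : ContDiffAt ℝ 1 f u :=
    (hf.contDiffOn.contDiffAt (hf.isOpen.mem_nhds hf.mem)).of_le (by simp)
  -- A linear projection `P` is a chart of the surface, as `P ∘ g` is a local diffeomorphism.
  obtain ⟨P, hP⟩ := (fderiv ℝ g u' : E2 →ₗ[ℝ] E4).exists_leftInverse_of_injective (by
    rw [LinearMap.ker_eq_bot']
    intro v hv
    by_contra h0
    have := hg.spacelike u' hg.mem v h0
    rw [show fderiv ℝ g u' v = 0 from hv, form_zero_left] at this
    exact lt_irrefl _ this)
  let P' : E4 →L[ℝ] E2 := LinearMap.toContinuousLinearMap P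
  have hPg : ContDiffAt ℝ 1 (P' ∘ g) u' := P'.contDiff.contDiffAt.comp u' hgd
  have hPg' : HasFDerivAt (P' ∘ g) ((ContinuousLinearEquiv.refl ℝ E2 : E2 ≃L[ℝ] E2) :
      E2 →L[ℝ] E2) u' := by
    have h1 := P'.hasFDerivAt.comp u' (hgd.differentiableAt one_ne_zero).hasFDerivAt
    have h2 : ((ContinuousLinearEquiv.refl ℝ E2 : E2 ≃L[ℝ] E2) : E2 →L[ℝ] E2) =
        P'.comp (fderiv ℝ g u') :=
      ContinuousLinearMap.ext fun v => (LinearMap.congr_fun hP v).symm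
    rw [h2]; exact h1
  let ρ := hPg.localInverse hPg' one_ne_zero
  have hρ : ContDiffAt ℝ 1 ρ (P' (g u')) := hPg.to_localInverse hPg' one_ne_zero
  have hleft : ∀ᶠ y in 𝓝 u', ρ (P' (g y)) = y :=
    (hPg.hasStrictFDerivAt' hPg' one_ne_zero).eventually_left_inverse
  have hfg : f u = g u' := by rw [hf.apply_eq, hg.apply_eq]
  have hρ' : ContDiffAt ℝ 1 ρ ((P' ∘ f) u) := by
    simpa only [Function.comp_apply, hfg] using hρ
  refine ⟨ρ ∘ (P' ∘ f), hρ'.comp u (P'.contDiff.contDiffAt.comp u hfd), ?_, ?_⟩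
  · simp only [Function.comp_apply, hfg]
    exact hleft.self_of_nhds
  -- Near `u`, the point `f w` is of the form `g w'` with `w'` near `u'`.
  obtain ⟨N, hN, hNo, huN⟩ := eventually_nhds_iff.1 hleft
  obtain ⟨O, hO, hON⟩ := hg.isEmbedding.isInducing.isOpen_iff.1
    (hNo.preimage (continuous_subtype_val : Continuous (Subtype.val : U' → E2)))
  obtain ⟨V, hV, hxV, hVf⟩ := hf.image_eq
  obtain ⟨V', hV', hxV', hVg⟩ := hg.image_eq
  obtain ⟨Q, hQ, hQV⟩ := isOpen_induced_iff.1 hV'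
  have huO : f u ∈ O := by
    rw [hfg]
    have : (⟨u', hg.mem⟩ : U') ∈ U'.domRestrict g ⁻¹' O := by rw [hON]; exact huN
    exact this
  have huQ : f u ∈ Q := by
    rw [hf.apply_eq]
    have : x ∈ Subtype.val ⁻¹' Q := by rw [hQV]; exact hxV'
    exact this
  have hcont := hfd.continuousAt
  filter_upwards [hf.isOpen.mem_nhds hf.mem, hcont.preimage_mem_nhds (hO.mem_nhds huO),
    hcont.preimage_mem_nhds (hQ.mem_nhds huQ)] with w hwU hwO hwQ
  obtain ⟨z, hz, hzw⟩ : f w ∈ Subtype.val '' (T ∩ V) := hVf ▸ ⟨w, hwU, rfl⟩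
  have hzV' : z ∈ V' := by
    rw [← hQV]
    change (z : E4) ∈ Q
    rw [hzw]; exact hwQ
  obtain ⟨w', hw', hgw'⟩ : f w ∈ g '' U' := by
    rw [hVg]; exact ⟨z, ⟨hz.1, hzV'⟩, hzw⟩
  have hw'N : w' ∈ N := by
    have : (⟨w', hw'⟩ : U') ∈ U'.domRestrict g ⁻¹' O := by
      change g w' ∈ O
      rw [hgw']; exact hwO
    rw [hON] at this
    exact this
  simp only [Function.comp_apply]
  rw [← hgw', hN w' hw'N]

/-- The shape operator of a surface at a point is unique up to conjugation, and exists in every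
parametrization if it exists in one. -/
theorem IsShapeOperatorAt.exists_conj {T : Set Quadric} {x : Quadric} {B : E2 →ₗ[ℝ] E2}
    (hB : IsShapeOperatorAt T x B) {U : Set E2} {f ν : E2 → E4} {u : E2}
    (hf : IsParamAt T x U f u) (hν : IsFutureNormal U f ν) :
    ∃ L : E2 ≃ₗ[ℝ] E2, ShapeRel f ν u (L.conj B) := by
  obtain ⟨U', g, u', μ, hg, hμ, hrel⟩ := hB
  obtain ⟨φ, hφ, hφu, hfg⟩ := hf.exists_transition hg
  have hpf := hf.normalPair hν
  have hpg := hg.normalPair hμ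
  have htop : (∞ : WithTop ℕ∞) ≠ 0 := by simp
  have hφ' : ∀ᶠ w in 𝓝 u, DifferentiableAt ℝ φ w :=
    (hφ.eventually (by simp)).mono fun w hw => hw.differentiableAt one_ne_zero
  have hU' : ∀ᶠ w in 𝓝 u, φ w ∈ U' :=
    hφ.continuousAt.preimage_mem_nhds (by rw [hφu]; exact hg.isOpen.mem_nhds hg.mem)
  have hder : ∀ᶠ w in 𝓝 u, ∀ v, fderiv ℝ f w v = fderiv ℝ g (φ w) (fderiv ℝ φ w v) := by
    filter_upwards [hfg.eventually_nhds, hφ', hU'] with w h1 h2 h3 v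
    have h1 : f =ᶠ[𝓝 w] g ∘ φ := h1
    rw [h1.fderiv_eq, fderiv_comp w (hpg.differentiableAt htop h3) h2]
    rfl
  have hνμ : ν =ᶠ[𝓝 u] μ ∘ φ := by
    filter_upwards [hfg, hder, hU', hf.isOpen.mem_nhds hf.mem] with w h1 h2 h3 h4
    simp only [Function.comp_apply] at h1
    refine normal_unique (x := f w) (L := (fderiv ℝ f w : E2 →ₗ[ℝ] E4)) (hpf.quadric w h4)
      (hpf.form_fderiv htop h4) (hpf.spacelike w h4) (hpf.tangent w h4) (hpf.normal w h4)
      (hpf.unit w h4) (hν.future w h4) ?_ ?_ (hpg.unit _ h3) ?_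
    · rw [h1]; exact hpg.tangent _ h3
    · intro v
      simp only [ContinuousLinearMap.coe_coe, h2 v]
      exact hpg.normal _ h3 _
    · rw [h1]; exact hμ.future _ h3
  have hinj : Function.Injective (fderiv ℝ φ u : E2 →ₗ[ℝ] E2) := by
    rw [← LinearMap.ker_eq_bot, LinearMap.ker_eq_bot']
    intro v hv
    by_contra h0
    have h1 := hpf.spacelike u hf.mem v h0
    rw [hder.self_of_nhds v, show fderiv ℝ φ u v = 0 from hv, map_zero, form_zero_left] at h1
    exact lt_irrefl _ h1
  let L := LinearEquiv.ofInjectiveEndo _ hinj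
  have hrel' : ShapeRel g μ (φ u) B := by rw [hφu]; exact hrel
  refine ⟨L.symm, (ShapeRel.comp (L := L) hrel' ?_ ?_ hφ'.self_of_nhds fun v => rfl).congr hfg.symm
    hνμ.symm⟩
  · exact hpg.differentiableAt htop hU'.self_of_nhds
  · exact hpg.differentiableAt_normal htop hU'.self_of_nhds

theorem ShapeRel.unique {U : Set E2} {f ν : E2 → E4} {u : E2} {n : WithTop ℕ∞}
    (hp : NormalPair n U f ν) (hu : u ∈ U) {B B' : E2 →ₗ[ℝ] E2}
    (h : ShapeRel f ν u B) (h' : ShapeRel f ν u B') : B = B' := by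
  refine LinearMap.ext fun v => ?_
  by_contra h0
  have := hp.spacelike u hu (B v - B' v) (sub_ne_zero.2 h0)
  rw [map_sub, h v, h' v, sub_self, form_zero_left] at this
  exact lt_irrefl _ this

/-- The characteristic polynomial, the trace and the determinant of the shape operator are
well-defined. -/
theorem IsShapeOperatorAt.invariants_eq {T : Set Quadric} {x : Quadric} {B B' : E2 →ₗ[ℝ] E2}
    (hB : IsShapeOperatorAt T x B) (hB' : IsShapeOperatorAt T x B') :
    B.charpoly = B'.charpoly ∧ LinearMap.trace ℝ E2 B = LinearMap.trace ℝ E2 B' ∧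
      LinearMap.det B = LinearMap.det B' := by
  obtain ⟨U, f, u, ν, hf, hν, hrel⟩ := hB'
  obtain ⟨L, hL⟩ := hB.exists_conj hf hν
  rw [← hL.unique (hf.normalPair hν) hf.mem hrel, LinearEquiv.charpoly_conj,
    LinearMap.trace_conj', LinearEquiv.conj_apply, LinearMap.comp_assoc, LinearMap.det_conj]
  exact ⟨rfl, rfl, rfl⟩

/-! ### Partial derivatives -/

/-- The derivative of `h` in the direction `v`, as a function. -/
def pd (v : E2) (h : E2 → ℝ) (w : E2) : ℝ := fderiv ℝ h w v

theorem contDiffOn_pd {O : Set E2} (hO : IsOpen O) {h : E2 → ℝ} {n : ℕ}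
    (hh : ContDiffOn ℝ (n + 1 : ℕ) h O) (v : E2) : ContDiffOn ℝ n (pd v h) O :=
  (hh.fderiv_of_isOpen hO (m := n) (by simp)).clm_apply contDiffOn_const

theorem pd_congr {O : Set E2} (hO : IsOpen O) {h k : E2 → ℝ} (hk : Set.EqOn h k O) (v : E2) :
    Set.EqOn (pd v h) (pd v k) O := fun w hw => by
  rw [pd, pd, (eventuallyEq_of_mem (hO.mem_nhds hw) hk).fderiv_eq]

theorem pd_comm {O : Set E2} (hO : IsOpen O) {h : E2 → ℝ} (hh : ContDiffOn ℝ (2 : ℕ) h O)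
    (v v' : E2) : Set.EqOn (pd v (pd v' h)) (pd v' (pd v h)) O := fun w hw => by
  have hc : ContDiffAt ℝ (2 : ℕ) h w := hh.contDiffAt (hO.mem_nhds hw)
  have hd : DifferentiableAt ℝ (fderiv ℝ h) w :=
    (hc.fderiv_right (m := 1) (by norm_num)).differentiableAt one_ne_zero
  have key : ∀ v v', pd v (pd v' h) w = fderiv ℝ (fderiv ℝ h) w v v' := by
    intro v v'
    have h1 : HasFDerivAt (fun y => fderiv ℝ h y v') ((fderiv ℝ (fderiv ℝ h) w).flip v') w := by
      simpa using hd.hasFDerivAt.clm_apply (hasFDerivAt_const v' w)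
    change fderiv ℝ (fun y => fderiv ℝ h y v') w v = _
    rw [h1.fderiv]; rfl
  rw [key, key]
  exact hc.isSymmSndFDerivAt (by simp) v v'

/-- Taylor's formula along the line of direction `v`. -/
theorem jet_line {O : Set E2} (hO : IsOpen O) (h0 : (0 : E2) ∈ O) {h : E2 → ℝ}
    (hh : ContDiffOn ℝ (2 : ℕ) h O) (v : E2) :
    Jet (fun t => h (t • v)) (h 0) (pd v h 0) (pd v (pd v h) 0 / 2) := by
  have hline : ∀ t : ℝ, HasDerivAt (fun t : ℝ => t • v) v t := fun t => by
    simpa using (hasDerivAt_id t).smul_const v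
  have key : ∀ {k : E2 → ℝ} {t : ℝ}, ContDiffOn ℝ (1 : ℕ) k O → t • v ∈ O →
      HasDerivAt (fun t => k (t • v)) (pd v k (t • v)) t := by
    intro k t hk ht
    have hd : DifferentiableAt ℝ k (t • v) :=
      (hk.contDiffAt (hO.mem_nhds ht)).differentiableAt (by simp)
    exact hd.hasFDerivAt.comp_hasDerivAt t (hline t)
  have hev : ∀ᶠ t : ℝ in 𝓝 0, t • v ∈ O := by
    have hc : ContinuousAt (fun t : ℝ => t • v) 0 := (hline 0).continuousAt
    exact hc.preimage_mem_nhds (hO.mem_nhds (by simpa using h0))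
  have := Jet.of_hasDerivAt (f := fun t => h (t • v)) (g := fun t => pd v h (t • v))
    (c := pd v (pd v h) 0)
    (hev.mono fun t ht => key (hh.of_le (by norm_num)) ht)
    (by simpa using key (t := 0) (contDiffOn_pd hO hh v) (by simpa using h0))
  simpa using this

/-! ### Space-like graphs in the Klein model -/

/-- The curvature equations of the graph of `Z` in the Klein model, at one point `(x, y)`. The first
derivatives of `Z` are `p` and `q`, its second derivatives are `r`, `s` and `t`; `l` is the factor
that normalizes `(1, x, y, Z)`, and `n` is the last coordinate of the unit normal. -/
theorem klein_curvature_algebra {l n x y Z p q r s t b00 b01 b10 b11 I00 I01 I11 : ℝ}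
    (hl : l ^ 2 * (1 - x ^ 2 - y ^ 2 + Z ^ 2) = 1)
    (hn : n ^ 2 * (1 + (Z - x * p - y * q) ^ 2 - p ^ 2 - q ^ 2) = 1)
    (h00 : I00 = l ^ 2 * (1 - p ^ 2) + l ^ 4 * (x - Z * p) ^ 2)
    (h01 : I01 = l ^ 2 * (-(p * q)) + l ^ 4 * ((x - Z * p) * (y - Z * q)))
    (h11 : I11 = l ^ 2 * (1 - q ^ 2) + l ^ 4 * (y - Z * q) ^ 2)
    (e00 : b00 * I00 + b10 * I01 = -(l * n * r)) (e01 : b00 * I01 + b10 * I11 = -(l * n * s))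
    (e10 : b01 * I00 + b11 * I01 = -(l * n * s)) (e11 : b01 * I01 + b11 * I11 = -(l * n * t)) :
    (b00 + b11) * l * (1 + (Z - x * p - y * q) ^ 2 - p ^ 2 - q ^ 2) =
      -n * (((1 - x ^ 2 - y ^ 2 + Z ^ 2) * (1 - q ^ 2) + (y - Z * q) ^ 2) * r
        + 2 * ((1 - x ^ 2 - y ^ 2 + Z ^ 2) * (p * q) - (x - Z * p) * (y - Z * q)) * s
        + ((1 - x ^ 2 - y ^ 2 + Z ^ 2) * (1 - p ^ 2) + (x - Z * p) ^ 2) * t) ∧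
    (b00 * b11 - b01 * b10) *
      ((1 + (Z - x * p - y * q) ^ 2 - p ^ 2 - q ^ 2) ^ 2 * (l ^ 2) ^ 2) = r * t - s ^ 2 := by
  have hl0 : l ≠ 0 := by rintro rfl; simp at hl
  set Dl := 1 + (Z - x * p - y * q) ^ 2 - p ^ 2 - q ^ 2 with hDl
  set L := 1 - x ^ 2 - y ^ 2 + Z ^ 2 with hL
  have hdet : I00 * I11 - I01 ^ 2 = l ^ 6 * Dl := by
    have : I00 * I11 - I01 ^ 2 - l ^ 6 * Dl = (1 - l ^ 2 * L) * (l ^ 4 * (1 - p ^ 2 - q ^ 2)) := by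
      rw [h00, h01, h11, hDl, hL]; ring
    rw [hl] at this
    linarith
  have k00 : I00 = l ^ 4 * (L * (1 - p ^ 2) + (x - Z * p) ^ 2) := by
    rw [h00]; linear_combination (-(l ^ 2 * (1 - p ^ 2))) * hl
  have k01 : I01 = l ^ 4 * (L * (-(p * q)) + (x - Z * p) * (y - Z * q)) := by
    rw [h01]; linear_combination (-(l ^ 2 * (-(p * q)))) * hl
  have k11 : I11 = l ^ 4 * (L * (1 - q ^ 2) + (y - Z * q) ^ 2) := by
    rw [h11]; linear_combination (-(l ^ 2 * (1 - q ^ 2))) * hl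
  constructor
  · have h1 : (b00 + b11) * (I00 * I11 - I01 ^ 2) =
        -(l * n) * (r * I11 - 2 * s * I01 + t * I00) := by
      linear_combination I11 * e00 - I01 * e01 - I01 * e10 + I00 * e11
    rw [hdet, k00, k01, k11] at h1
    have hl5 : l ^ 5 ≠ 0 := pow_ne_zero _ hl0
    apply mul_left_cancel₀ hl5
    linear_combination h1
  · have h2 : (b00 * b11 - b01 * b10) * (I00 * I11 - I01 ^ 2) =
        l ^ 2 * n ^ 2 * (r * t - s ^ 2) := by
      linear_combination (b01 * I01 + b11 * I11) * e00 - (b01 * I00 + b11 * I01) * e01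
        + (l * n * s) * e10 - (l * n * r) * e11
    rw [hdet] at h2
    have hl2 : l ^ 2 ≠ 0 := pow_ne_zero _ hl0
    apply mul_left_cancel₀ hl2
    linear_combination Dl * h2 + l ^ 2 * (r * t - s ^ 2) * hn

/-- The coordinates of the derivatives of `f = l (1, x, y, Z)`, where `l` is the coordinate of index
`0` of `f`. -/
theorem fderiv_klein {O : Set E2} (hO : IsOpen O) {f : E2 → E4} {Z : E2 → ℝ} {w : E2} (hw : w ∈ O)
    (hf : DifferentiableAt ℝ f w) (hZ : DifferentiableAt ℝ Z w)
    (h1 : ∀ w ∈ O, f w 1 = f w 0 * w 0) (h2 : ∀ w ∈ O, f w 2 = f w 0 * w 1)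
    (h3 : ∀ w ∈ O, f w 3 = f w 0 * Z w) (v : E2) :
    fderiv ℝ f w v 1 = f w 0 * v 0 + w 0 * fderiv ℝ f w v 0 ∧
    fderiv ℝ f w v 2 = f w 0 * v 1 + w 1 * fderiv ℝ f w v 0 ∧
    fderiv ℝ f w v 3 = f w 0 * fderiv ℝ Z w v + Z w * fderiv ℝ f w v 0 := by
  have hc := hasFDerivAt_pi'.1 hf.hasFDerivAt
  have hx : ∀ i, HasFDerivAt (fun y : E2 => y i) (ContinuousLinearMap.proj (R := ℝ) i) w :=
    fun i => (ContinuousLinearMap.proj (R := ℝ) (φ := fun _ : Fin 2 => ℝ) i).hasFDerivAt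
  have key : ∀ {i : Fin 4} {k : E2 → ℝ} {k' : E2 →L[ℝ] ℝ}, (∀ w ∈ O, f w i = f w 0 * k w) →
      HasFDerivAt k k' w → fderiv ℝ f w v i = f w 0 * k' v + k w * fderiv ℝ f w v 0 := by
    intro i k k' hk hk'
    have e := (hc i).unique (((hc 0).mul hk').congr_of_eventuallyEq
      (eventuallyEq_of_mem (hO.mem_nhds hw) hk))
    have := congrArg (fun T : E2 →L[ℝ] ℝ => T v) e
    simpa using this
  exact ⟨key h1 (hx 0), key h2 (hx 1), key h3 hZ.hasFDerivAt⟩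

/-- The first standard basis vector of the parameter plane. -/
def ex : E2 := ![1, 0]

/-- The second standard basis vector of the parameter plane. -/
def ey : E2 := ![0, 1]

theorem eq_smul_ex_add_smul_ey (v : E2) : v = v 0 • ex + v 1 • ey := by
  ext i; fin_cases i <;> simp [ex, ey]

theorem trace_det_eq (B : E2 →ₗ[ℝ] E2) :
    LinearMap.trace ℝ E2 B = B ex 0 + B ey 1 ∧
      LinearMap.det B = B ex 0 * B ey 1 - B ey 0 * B ex 1 := by
  have h0 : (Pi.single 0 1 : E2) = ex := by ext i; fin_cases i <;> simp [ex]
  have h1 : (Pi.single 1 1 : E2) = ey := by ext i; fin_cases i <;> simp [ey]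
  have hM : LinearMap.toMatrix (Pi.basisFun ℝ (Fin 2)) (Pi.basisFun ℝ (Fin 2)) B =
      !![B ex 0, B ey 0; B ex 1, B ey 1] := by
    ext i j
    rw [LinearMap.toMatrix_apply]
    fin_cases i <;> fin_cases j <;> simp [h0, h1]
  rw [← LinearMap.det_toMatrix (Pi.basisFun ℝ (Fin 2)) B,
    LinearMap.trace_eq_matrix_trace ℝ (Pi.basisFun ℝ (Fin 2)) B, hM, Matrix.det_fin_two,
    Matrix.trace_fin_two]
  simp

/-- The normal field of a graph `f = l (1, x, y, Z)` in the Klein model. -/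
theorem normal_klein {n : WithTop ℕ∞} (hn : n ≠ 0) {O : Set E2} {f ν : E2 → E4} {Z : E2 → ℝ}
    (hp : NormalPair n O f ν) (hZ : DifferentiableOn ℝ Z O)
    (h1 : ∀ w ∈ O, f w 1 = f w 0 * w 0) (h2 : ∀ w ∈ O, f w 2 = f w 0 * w 1)
    (h3 : ∀ w ∈ O, f w 3 = f w 0 * Z w) {w : E2} (hw : w ∈ O) :
    f w 0 ^ 2 * (1 - w 0 ^ 2 - w 1 ^ 2 + Z w ^ 2) = 1 ∧ f w 0 ≠ 0 ∧
    ν w 1 = pd ex Z w * ν w 3 ∧ ν w 2 = pd ey Z w * ν w 3 ∧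
    ν w 0 = w 0 * ν w 1 + w 1 * ν w 2 - Z w * ν w 3 := by
  have hq := hp.quadric w hw
  have ht := hp.tangent w hw
  simp only [form, h1 w hw, h2 w hw, h3 w hw] at hq ht
  have hl : f w 0 ^ 2 * (1 - w 0 ^ 2 - w 1 ^ 2 + Z w ^ 2) = 1 := by linarith
  have hl0 : f w 0 ≠ 0 := by intro h; simp [h] at hl
  have hν0 : ν w 0 = w 0 * ν w 1 + w 1 * ν w 2 - Z w * ν w 3 := by
    apply mul_left_cancel₀ hl0; linarith
  have hν : ∀ v, v 0 * ν w 1 + v 1 * ν w 2 = fderiv ℝ Z w v * ν w 3 := by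
    intro v
    have := hp.normal w hw v
    obtain ⟨k1, k2, k3⟩ := fderiv_klein hp.isOpen hw (hp.differentiableAt hn hw)
      ((hZ w hw).differentiableAt (hp.isOpen.mem_nhds hw)) h1 h2 h3 v
    simp only [form, k1, k2, k3, hν0] at this
    apply mul_left_cancel₀ hl0; linarith
  refine ⟨hl, hl0, ?_, ?_, hν0⟩
  · simpa [ex, pd] using hν ex
  · simpa [ey, pd] using hν ey

/-- The second fundamental form of a graph in the Klein model is conformal to the Hessian of the
function, as the model is projective. -/
theorem second_form_klein {n : WithTop ℕ∞} (hn : n ≠ 0) {O : Set E2} {f ν : E2 → E4} {Z : E2 → ℝ}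
    (hp : NormalPair n O f ν) (hZ : ContDiffOn ℝ (2 : ℕ) Z O)
    (h1 : ∀ w ∈ O, f w 1 = f w 0 * w 0) (h2 : ∀ w ∈ O, f w 2 = f w 0 * w 1)
    (h3 : ∀ w ∈ O, f w 3 = f w 0 * Z w) {w : E2} (hw : w ∈ O) (v v' : E2) :
    form (fderiv ℝ ν w v) (fderiv ℝ f w v') = f w 0 * ν w 3 *
      (v' 0 * pd v (pd ex Z) w + v' 1 * pd v (pd ey Z) w) := by
  have hZd : DifferentiableOn ℝ Z O := hZ.differentiableOn (by simp)
  have hN := fun {w} => normal_klein hn hp hZd h1 h2 h3 (w := w)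
  have hZw := (hZd w hw).differentiableAt (hp.isOpen.mem_nhds hw)
  have hpd : ∀ v, HasFDerivAt (pd v Z) (fderiv ℝ (pd v Z) w) w := fun v =>
    (((contDiffOn_pd hp.isOpen hZ v).contDiffAt (hp.isOpen.mem_nhds hw)).differentiableAt
      (by simp)).hasFDerivAt
  obtain ⟨k1, k2, k3⟩ := fderiv_klein hp.isOpen hw (hp.differentiableAt hn hw) hZw h1 h2 h3 v'
  have hc := hasFDerivAt_pi'.1 (hp.differentiableAt_normal hn hw).hasFDerivAt
  have hx : ∀ i, HasFDerivAt (fun y : E2 => y i) (ContinuousLinearMap.proj (R := ℝ) i) w :=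
    fun i => (ContinuousLinearMap.proj (R := ℝ) (φ := fun _ : Fin 2 => ℝ) i).hasFDerivAt
  have hmem := hp.isOpen.mem_nhds hw
  have d1 : fderiv ℝ ν w v 1 = pd ex Z w * fderiv ℝ ν w v 3 + ν w 3 * pd v (pd ex Z) w := by
    have e := (hc 1).unique (((hpd ex).mul (hc 3)).congr_of_eventuallyEq
      (eventuallyEq_of_mem hmem fun w hw => (hN hw).2.2.1))
    have := congrArg (fun T : E2 →L[ℝ] ℝ => T v) e
    simpa [pd] using this
  have d2 : fderiv ℝ ν w v 2 = pd ey Z w * fderiv ℝ ν w v 3 + ν w 3 * pd v (pd ey Z) w := by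
    have e := (hc 2).unique (((hpd ey).mul (hc 3)).congr_of_eventuallyEq
      (eventuallyEq_of_mem hmem fun w hw => (hN hw).2.2.2.1))
    have := congrArg (fun T : E2 →L[ℝ] ℝ => T v) e
    simpa [pd] using this
  have d0 : fderiv ℝ ν w v 0 = (w 0 * fderiv ℝ ν w v 1 + ν w 1 * v 0) +
      (w 1 * fderiv ℝ ν w v 2 + ν w 2 * v 1) -
      (Z w * fderiv ℝ ν w v 3 + ν w 3 * fderiv ℝ Z w v) := by
    have e := (hc 0).unique (((((hx 0).mul (hc 1)).add ((hx 1).mul (hc 2))).sub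
      (hZw.hasFDerivAt.mul (hc 3))).congr_of_eventuallyEq
      (eventuallyEq_of_mem hmem fun w hw => (hN hw).2.2.2.2))
    have := congrArg (fun T : E2 →L[ℝ] ℝ => T v) e
    simpa using this
  have hZv : ∀ v, fderiv ℝ Z w v = v 0 * pd ex Z w + v 1 * pd ey Z w := by
    intro v
    conv_lhs => rw [eq_smul_ex_add_smul_ey v]
    simp [pd]
  obtain ⟨-, -, n1, n2, -⟩ := hN hw
  simp only [form, k1, k2, k3, d0, d1, d2, hZv, n1, n2]
  ring

/-- The curvature equations of a graph `f = l (1, x, y, Z)` in the Klein model. -/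
theorem curvature_klein {n : WithTop ℕ∞} (hn : n ≠ 0) {O : Set E2} {f ν : E2 → E4} {Z : E2 → ℝ}
    (hp : NormalPair n O f ν) (hZ : ContDiffOn ℝ (2 : ℕ) Z O)
    (h1 : ∀ w ∈ O, f w 1 = f w 0 * w 0) (h2 : ∀ w ∈ O, f w 2 = f w 0 * w 1)
    (h3 : ∀ w ∈ O, f w 3 = f w 0 * Z w) {w : E2} (hw : w ∈ O) :
    f w 0 ^ 2 * (1 - w 0 ^ 2 - w 1 ^ 2 + Z w ^ 2) = 1 ∧
    ν w 3 ^ 2 * (1 + (Z w - w 0 * pd ex Z w - w 1 * pd ey Z w) ^ 2 - pd ex Z w ^ 2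
      - pd ey Z w ^ 2) = 1 ∧
    ∀ B, ShapeRel f ν w B →
    LinearMap.trace ℝ E2 B * f w 0 *
        (1 + (Z w - w 0 * pd ex Z w - w 1 * pd ey Z w) ^ 2 - pd ex Z w ^ 2 - pd ey Z w ^ 2) =
      -ν w 3 * (((1 - w 0 ^ 2 - w 1 ^ 2 + Z w ^ 2) * (1 - pd ey Z w ^ 2)
          + (w 1 - Z w * pd ey Z w) ^ 2) * pd ex (pd ex Z) w
        + 2 * ((1 - w 0 ^ 2 - w 1 ^ 2 + Z w ^ 2) * (pd ex Z w * pd ey Z w)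
          - (w 0 - Z w * pd ex Z w) * (w 1 - Z w * pd ey Z w)) * pd ex (pd ey Z) w
        + ((1 - w 0 ^ 2 - w 1 ^ 2 + Z w ^ 2) * (1 - pd ex Z w ^ 2)
          + (w 0 - Z w * pd ex Z w) ^ 2) * pd ey (pd ey Z) w) ∧
    LinearMap.det B *
      ((1 + (Z w - w 0 * pd ex Z w - w 1 * pd ey Z w) ^ 2 - pd ex Z w ^ 2 - pd ey Z w ^ 2) ^ 2
        * (f w 0 ^ 2) ^ 2) = pd ex (pd ex Z) w * pd ey (pd ey Z) w - pd ex (pd ey Z) w ^ 2 := by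
  have hZd : DifferentiableOn ℝ Z O := hZ.differentiableOn (by simp)
  have hZw := (hZd w hw).differentiableAt (hp.isOpen.mem_nhds hw)
  obtain ⟨hl, hl0, n1, n2, n0⟩ := normal_klein hn hp hZd h1 h2 h3 hw
  have hunit := hp.unit w hw
  have hν3 : ν w 3 ^ 2 * (1 + (Z w - w 0 * pd ex Z w - w 1 * pd ey Z w) ^ 2 - pd ex Z w ^ 2
      - pd ey Z w ^ 2) = 1 := by
    simp only [form, n0, n1, n2] at hunit
    linarith
  refine ⟨hl, hν3, fun B hB => ?_⟩
  have hZv : ∀ v, fderiv ℝ Z w v = v 0 * pd ex Z w + v 1 * pd ey Z w := by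
    intro v
    conv_lhs => rw [eq_smul_ex_add_smul_ey v]
    simp [pd]
  -- The derivative of the factor `l`, from `⟨f, df⟩ = 0`.
  have hdl : ∀ v, fderiv ℝ f w v 0 = f w 0 ^ 3 * (v 0 * (w 0 - Z w * pd ex Z w) +
      v 1 * (w 1 - Z w * pd ey Z w)) := by
    intro v
    have := hp.form_fderiv hn hw v
    obtain ⟨k1, k2, k3⟩ := fderiv_klein hp.isOpen hw (hp.differentiableAt hn hw) hZw h1 h2 h3 v
    simp only [form, k1, k2, k3, hZv, h1 w hw, h2 w hw, h3 w hw] at this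
    apply mul_left_cancel₀ hl0
    linear_combination (-f w 0 ^ 2) * this - (f w 0 * fderiv ℝ f w v 0) * hl
  -- The first fundamental form.
  have hI : ∀ v v', form (fderiv ℝ f w v) (fderiv ℝ f w v') = f w 0 ^ 2 * (v 0 * v' 0 + v 1 * v' 1
      - (v 0 * pd ex Z w + v 1 * pd ey Z w) * (v' 0 * pd ex Z w + v' 1 * pd ey Z w)) +
      f w 0 ^ 4 * ((v 0 * (w 0 - Z w * pd ex Z w) + v 1 * (w 1 - Z w * pd ey Z w)) *
        (v' 0 * (w 0 - Z w * pd ex Z w) + v' 1 * (w 1 - Z w * pd ey Z w))) := by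
    intro v v'
    obtain ⟨k1, k2, k3⟩ := fderiv_klein hp.isOpen hw (hp.differentiableAt hn hw) hZw h1 h2 h3 v
    obtain ⟨k1', k2', k3'⟩ :=
      fderiv_klein hp.isOpen hw (hp.differentiableAt hn hw) hZw h1 h2 h3 v'
    simp only [form, k1, k2, k3, k1', k2', k3', hZv, hdl]
    linear_combination (-f w 0 ^ 4 *
      ((v 0 * (w 0 - Z w * pd ex Z w) + v 1 * (w 1 - Z w * pd ey Z w)) *
        (v' 0 * (w 0 - Z w * pd ex Z w) + v' 1 * (w 1 - Z w * pd ey Z w)))) * hl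
  have hII : ∀ v v', form (fderiv ℝ f w (B v)) (fderiv ℝ f w v') = -(f w 0 * ν w 3 *
      (v' 0 * pd v (pd ex Z) w + v' 1 * pd v (pd ey Z) w)) := by
    intro v v'
    rw [hp.form_shape hn hw hB, second_form_klein hn hp hZ h1 h2 h3 hw]
  have hsym : pd ey (pd ex Z) w = pd ex (pd ey Z) w := pd_comm hp.isOpen hZ ey ex hw
  have hexp : ∀ v v', form (fderiv ℝ f w v) (fderiv ℝ f w v') =
      v 0 * form (fderiv ℝ f w ex) (fderiv ℝ f w v') +
        v 1 * form (fderiv ℝ f w ey) (fderiv ℝ f w v') := by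
    intro v v'
    conv_lhs => rw [eq_smul_ex_add_smul_ey v]
    rw [map_add, map_smul, map_smul, form_add_left, form_smul_left, form_smul_left]
  have ex0 : ex 0 = 1 := rfl
  have ex1 : ex 1 = 0 := rfl
  have ey0 : ey 0 = 0 := rfl
  have ey1 : ey 1 = 1 := rfl
  obtain ⟨htr, hdet⟩ := trace_det_eq B
  rw [htr, hdet]
  have e00 := hII ex ex
  have e01 := hII ex ey
  have e10 := hII ey ex
  have e11 := hII ey ey
  rw [hexp (B _)] at e00 e01 e10 e11
  rw [form_comm (fderiv ℝ f w ey) (fderiv ℝ f w ex)] at e00 e10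
  refine klein_curvature_algebra hl hν3 (I00 := form (fderiv ℝ f w ex) (fderiv ℝ f w ex))
    (I01 := form (fderiv ℝ f w ex) (fderiv ℝ f w ey))
    (I11 := form (fderiv ℝ f w ey) (fderiv ℝ f w ey)) (b00 := B ex 0) (b10 := B ex 1)
    (b01 := B ey 0) (b11 := B ey 1) ?_ ?_ ?_ ?_ ?_ ?_ ?_
  · rw [hI, ex0, ex1]; ring
  · rw [hI, ex0, ex1, ey0, ey1]; ring
  · rw [hI, ey0, ey1]; ring
  · rw [e00, ex0, ex1]; ring
  · rw [e01, ey0, ey1]; ring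
  · rw [e10, ex0, ex1, hsym]; ring
  · rw [e11, ey0, ey1]; ring

/-! ### The curvature at a minimum of the determinant of the shape operator -/

theorem eventually_line_mem {O : Set E2} (hO : IsOpen O) (h0 : (0 : E2) ∈ O) (v : E2) :
    ∀ᶠ t : ℝ in 𝓝 0, t • v ∈ O := by
  have hc : Continuous fun t : ℝ => t • v := by fun_prop
  exact hc.continuousAt.preimage_mem_nhds (hO.mem_nhds (by simpa using h0))

/-- A minimum of the determinant `κ` of the shape operator, for a graph of constant mean curvature
in the Klein model that is tangent to the coordinate plane, with principal directions along the
axes. -/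
theorem neg_one_le_of_klein_min {O : Set E2} {f ν : E2 → E4} {Z κ : E2 → ℝ} {τ : ℝ}
    (hp : NormalPair (4 : ℕ) O f ν) (h0 : (0 : E2) ∈ O) (hZ : ContDiffOn ℝ (4 : ℕ) Z O)
    (h1 : ∀ w ∈ O, f w 1 = f w 0 * w 0) (h2 : ∀ w ∈ O, f w 2 = f w 0 * w 1)
    (h3 : ∀ w ∈ O, f w 3 = f w 0 * Z w)
    (hB : ∀ w ∈ O, ∃ B, ShapeRel f ν w B ∧ LinearMap.trace ℝ E2 B = τ ∧ LinearMap.det B = κ w)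
    (hf0 : f 0 0 = 1) (hZ0 : Z 0 = 0) (hν0 : ν 0 = ![0, 0, 0, 1])
    (hdiag : form (fderiv ℝ ν 0 ex) (fderiv ℝ f 0 ey) = 0)
    (hmin : ∀ w ∈ O, κ 0 ≤ κ w) : -1 ≤ κ 0 := by
  have hn : ((4 : ℕ) : WithTop ℕ∞) ≠ 0 := by simp
  have hO := hp.isOpen
  have hZ2 : ContDiffOn ℝ (2 : ℕ) Z O := hZ.of_le (by norm_num)
  have hZd : DifferentiableOn ℝ Z O := hZ.differentiableOn hn
  set p := pd ex Z with hpdef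
  set q := pd ey Z with hqdef
  have hp3 : ContDiffOn ℝ (3 : ℕ) p O := contDiffOn_pd hO hZ ex
  have hq3 : ContDiffOn ℝ (3 : ℕ) q O := contDiffOn_pd hO hZ ey
  have hp2 : ContDiffOn ℝ (2 : ℕ) p O := hp3.of_le (by norm_num)
  have hq2 : ContDiffOn ℝ (2 : ℕ) q O := hq3.of_le (by norm_num)
  have hr2 : ContDiffOn ℝ (2 : ℕ) (pd ex p) O := contDiffOn_pd hO hp3 ex
  have hs2 : ContDiffOn ℝ (2 : ℕ) (pd ex q) O := contDiffOn_pd hO hq3 ex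
  have hs2' : ContDiffOn ℝ (2 : ℕ) (pd ey p) O := contDiffOn_pd hO hp3 ey
  have ht2 : ContDiffOn ℝ (2 : ℕ) (pd ey q) O := contDiffOn_pd hO hq3 ey
  have hsym : Set.EqOn (pd ey p) (pd ex q) O := pd_comm hO hZ2 ey ex
  -- The partial derivatives of order one at the origin vanish, and the mixed one of order two.
  obtain ⟨-, -, n1, n2, -⟩ := normal_klein hn hp hZd h1 h2 h3 h0
  have hν3 : ν 0 3 = 1 := by rw [hν0]; rfl
  have hν1 : ν 0 1 = 0 := by rw [hν0]; rfl
  have hν2 : ν 0 2 = 0 := by rw [hν0]; rfl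
  have hp0 : p 0 = 0 := by rw [hν1, hν3] at n1; linarith
  have hq0 : q 0 = 0 := by rw [hν2, hν3] at n2; linarith
  have hs0 : pd ex q 0 = 0 := by
    rw [second_form_klein hn hp hZ2 h1 h2 h3 h0, hf0, hν3] at hdiag
    have ey0 : ey 0 = 0 := rfl
    have ey1 : ey 1 = 1 := rfl
    rw [ey0, ey1] at hdiag
    simpa using hdiag
  have hs0' : pd ey p 0 = 0 := by rw [hsym h0, hs0]
  have hcurv := fun {w} (hw : w ∈ O) => curvature_klein hn hp hZ2 h1 h2 h3 hw
  have hκ0 : κ 0 = pd ex p 0 * pd ey q 0 := by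
    obtain ⟨B, hB, -, hd⟩ := hB 0 h0
    have := ((hcurv h0).2.2 B hB).2
    rw [hd, ← hpdef, ← hqdef, hZ0, hp0, hq0, hs0, hf0] at this
    simpa using this
  -- The relations between the derivatives of `Z` of order three and four.
  have c1 : pd ey (pd ex p) 0 = pd ex (pd ex q) 0 := by
    rw [pd_comm hO hp2 ey ex h0]; exact pd_congr hO hsym ex h0
  have c2 : pd ex (pd ey q) 0 = pd ey (pd ey p) 0 := by
    rw [pd_comm hO hq2 ex ey h0]; exact (pd_congr hO hsym ey h0).symm
  have c3 : pd ex (pd ex (pd ey q)) 0 = pd ey (pd ey (pd ex p)) 0 := by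
    have e1 : Set.EqOn (pd ex (pd ey q)) (pd ey (pd ex q)) O := pd_comm hO hq2 ex ey
    have e2 : Set.EqOn (pd ey (pd ex p)) (pd ex (pd ex q)) O :=
      (pd_comm hO hp2 ey ex).trans (pd_congr hO hsym ex)
    rw [pd_congr hO e1 ex h0, pd_congr hO e2 ey h0]
    exact pd_comm hO hs2 ex ey h0
  have hl2 : ContDiffOn ℝ (2 : ℕ) (fun w => f w 0) O :=
    (contDiffOn_pi.1 hp.contDiffOn 0).of_le (by norm_num)
  have hn2 : ContDiffOn ℝ (2 : ℕ) (fun w => ν w 3) O :=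
    (contDiffOn_pi.1 hp.contDiffOn_normal 3).of_le (by norm_num)
  have hx0 : ∀ t : ℝ, (t • ex) 0 = t := fun t => by simp [ex]
  have hx1 : ∀ t : ℝ, (t • ex) 1 = 0 := fun t => by simp [ex]
  have hy0 : ∀ t : ℝ, (t • ey) 0 = 0 := fun t => by simp [ey]
  have hy1 : ∀ t : ℝ, (t • ey) 1 = t := fun t => by simp [ey]
  have jx := fun {h : E2 → ℝ} (hh : ContDiffOn ℝ (2 : ℕ) h O) => jet_line hO h0 hh ex
  have jy := fun {h : E2 → ℝ} (hh : ContDiffOn ℝ (2 : ℕ) h O) => jet_line hO h0 hh ey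
  have lx := eventually_line_mem hO h0 ex
  have ly := eventually_line_mem hO h0 ey
  have X := axis_expansion (a := pd ex p 0) (b := pd ey q 0) (τ := τ)
    (κ := fun t => κ (t • ex))
    (d₁ := pd ex (pd ex p) 0 / 2) (e₁ := pd ex (pd ex q) 0 / 2)
    (by simpa only [hf0] using jx hl2) (by simpa only [hν3] using jx hn2)
    (by simpa only [hZ0, ← hpdef, hp0] using jx hZ2)
    (by simpa only [hp0] using jx hp2)
    (by simpa only [hq0, hs0] using jx hq2)
    (by simpa only [mul_div_cancel₀ _ (two_ne_zero' ℝ)] using jx hr2)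
    (by simpa only [mul_div_cancel₀ _ (two_ne_zero' ℝ), hs0] using jx hs2)
    (jx ht2)
    (by
      filter_upwards [lx] with t ht
      have := (hcurv ht).1
      rw [hx0, hx1] at this; linarith)
    (by
      filter_upwards [lx] with t ht
      have := (hcurv ht).2.1
      rw [hx0, hx1] at this; linarith)
    (by
      filter_upwards [lx] with t ht
      obtain ⟨B, hBs, htr, -⟩ := hB _ ht
      have := ((hcurv ht).2.2 B hBs).1
      rw [hx0, hx1, htr] at this; linarith)
    (by
      filter_upwards [lx] with t ht
      obtain ⟨B, hBs, -, hd⟩ := hB _ ht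
      have := ((hcurv ht).2.2 B hBs).2
      rw [hx0, hx1, hd] at this; linarith)
    (by
      filter_upwards [lx] with t ht
      rw [← hκ0]; exact hmin _ ht)
  have Y := axis_expansion (a := pd ey q 0) (b := pd ex p 0) (τ := τ)
    (κ := fun t => κ (t • ey))
    (d₁ := pd ey (pd ey q) 0 / 2) (e₁ := pd ey (pd ey p) 0 / 2)
    (by simpa only [hf0] using jy hl2) (by simpa only [hν3] using jy hn2)
    (by simpa only [hZ0, ← hqdef, hq0] using jy hZ2)
    (by simpa only [hq0] using jy hq2)
    (by simpa only [hp0, hs0'] using jy hp2)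
    (by simpa only [mul_div_cancel₀ _ (two_ne_zero' ℝ)] using jy ht2)
    (by simpa only [mul_div_cancel₀ _ (two_ne_zero' ℝ), hs0'] using jy hs2')
    (jy hr2)
    (by
      filter_upwards [ly] with t ht
      have := (hcurv ht).1
      rw [hy0, hy1] at this; linarith)
    (by
      filter_upwards [ly] with t ht
      have := (hcurv ht).2.1
      rw [hy0, hy1] at this; linarith)
    (by
      filter_upwards [ly] with t ht
      obtain ⟨B, hBs, htr, -⟩ := hB _ ht
      have := ((hcurv ht).2.2 B hBs).1
      rw [hy0, hy1, htr] at this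
      rw [hsym ht]; linarith)
    (by
      filter_upwards [ly] with t ht
      obtain ⟨B, hBs, -, hd⟩ := hB _ ht
      have := ((hcurv ht).2.2 B hBs).2
      rw [hy0, hy1, hd] at this
      rw [hsym ht]; linarith)
    (by
      filter_upwards [ly] with t ht
      rw [mul_comm, ← hκ0]; exact hmin _ ht)
  obtain ⟨-, X1, X2, X3, X4⟩ := X
  obtain ⟨-, Y1, Y2, Y3, Y4⟩ := Y
  rw [hκ0]
  rw [c3] at X3 X4
  have X4' : 4 * (pd ex (pd ex q) 0 / 2) ^ 2 = pd ey (pd ex p) 0 ^ 2 := by rw [c1]; ring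
  have Y4' : 4 * (pd ey (pd ey p) 0 / 2) ^ 2 = pd ex (pd ey q) 0 ^ 2 := by rw [c2]; ring
  rw [X4'] at X4
  rw [Y4'] at Y4
  exact neg_one_le_of_axis_relations X1 X2 X3 X4 Y1 Y2 Y3 Y4

/-! ### Adapted coordinates at a point of a surface -/

theorem eq_zero_of_form_map_eq_zero {A : E4 →ₗ[ℝ] E4} (hA : ∀ x y, form (A x) (A y) = form x y)
    {x : E4} (hx : A x = 0) : x = 0 :=
  eq_zero_of_forall_form fun y => by rw [← hA, hx, form_zero_left]

/-- A linear map that preserves the form is invertible, and its inverse preserves the form. -/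
theorem exists_form_equiv {A : E4 →ₗ[ℝ] E4} (hA : ∀ x y, form (A x) (A y) = form x y) :
    ∃ E : E4 ≃ₗ[ℝ] E4, (∀ x, E x = A x) ∧
      ∀ x y, form (E.symm x) (E.symm y) = form x y := by
  have hinj : Function.Injective A := by
    rw [← LinearMap.ker_eq_bot, LinearMap.ker_eq_bot']
    exact fun x => eq_zero_of_form_map_eq_zero hA
  let E := LinearEquiv.ofInjectiveEndo A hinj
  have hE : ∀ x, E x = A x := fun x => rfl
  refine ⟨E, hE, fun x y => ?_⟩
  rw [← hA, ← hE, ← hE, E.apply_symm_apply, E.apply_symm_apply]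

/-- A pseudo-orthonormal frame is mapped to the standard one by an isometry of the form. -/
theorem exists_frame_map {p e₁ e₂ n : E4} (hpp : form p p = -1) (h11 : form e₁ e₁ = 1)
    (h22 : form e₂ e₂ = 1) (hnn : form n n = -1) (hp1 : form p e₁ = 0) (hp2 : form p e₂ = 0)
    (hpn : form p n = 0) (h12 : form e₁ e₂ = 0) (h1n : form e₁ n = 0) (h2n : form e₂ n = 0) :
    ∃ A : E4 →ₗ[ℝ] E4, (∀ x y, form (A x) (A y) = form x y) ∧ A p = ![1, 0, 0, 0] ∧
      A e₁ = ![0, 1, 0, 0] ∧ A e₂ = ![0, 0, 1, 0] ∧ A n = ![0, 0, 0, 1] := by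
  let T : E4 →ₗ[ℝ] E4 := (LinearMap.proj 0).smulRight p + (LinearMap.proj 1).smulRight e₁ +
    (LinearMap.proj 2).smulRight e₂ + (LinearMap.proj 3).smulRight n
  have hT : ∀ y, T y = y 0 • p + y 1 • e₁ + y 2 • e₂ + y 3 • n := fun y => by simp [T]
  have hform : ∀ x y, form (T x) (T y) = form x y := by
    intro x y
    rw [hT, hT]
    simp only [form_add_left, form_add_right, form_smul_left, form_smul_right, hpp, h11, h22, hnn,
      hp1, hp2, hpn, h12, h1n, h2n, form_comm e₁ p, form_comm e₂ p, form_comm n p, form_comm e₂ e₁,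
      form_comm n e₁, form_comm n e₂]
    rw [form]; ring
  obtain ⟨E, hE, hEs⟩ := exists_form_equiv hform
  refine ⟨E.symm, hEs, ?_, ?_, ?_, ?_⟩ <;>
    · change E.symm _ = _
      rw [LinearEquiv.symm_apply_eq, hE, hT]
      simp

theorem fderiv_linear_comp {f : E2 → E4} {w : E2} (A : E4 →ₗ[ℝ] E4) (hf : DifferentiableAt ℝ f w)
    (v : E2) : fderiv ℝ (fun w => A (f w)) w v = A (fderiv ℝ f w v) := by
  have := (A.toContinuousLinearMap.hasFDerivAt (x := f w)).comp w hf.hasFDerivAt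
  have h2 : HasFDerivAt (fun w => A (f w)) (A.toContinuousLinearMap.comp (fderiv ℝ f w)) w := this
  rw [h2.fderiv]; rfl

theorem contDiffOn_linear_comp {n : WithTop ℕ∞} {f : E2 → E4} {U : Set E2} (A : E4 →ₗ[ℝ] E4)
    (hf : ContDiffOn ℝ n f U) : ContDiffOn ℝ n (fun w => A (f w)) U :=
  A.toContinuousLinearMap.contDiff.comp_contDiffOn hf

theorem NormalPair.map {n : WithTop ℕ∞} {U : Set E2} {f ν : E2 → E4} (h : NormalPair n U f ν)
    (hn : n ≠ 0) {A : E4 →ₗ[ℝ] E4} (hA : ∀ x y, form (A x) (A y) = form x y) :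
    NormalPair n U (fun w => A (f w)) (fun w => A (ν w)) where
  isOpen := h.isOpen
  contDiffOn := contDiffOn_linear_comp A h.contDiffOn
  contDiffOn_normal := contDiffOn_linear_comp A h.contDiffOn_normal
  quadric w hw := by rw [hA, h.quadric w hw]
  spacelike w hw v hv := by
    rw [fderiv_linear_comp A (h.differentiableAt hn hw), hA]; exact h.spacelike w hw v hv
  tangent w hw := by rw [hA, h.tangent w hw]
  normal w hw v := by
    rw [fderiv_linear_comp A (h.differentiableAt hn hw), hA]; exact h.normal w hw v
  unit w hw := by rw [hA, h.unit w hw]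

theorem ShapeRel.map {f ν : E2 → E4} {u : E2} {B : E2 →ₗ[ℝ] E2} (h : ShapeRel f ν u B)
    (hf : DifferentiableAt ℝ f u) (hν : DifferentiableAt ℝ ν u) {A : E4 →ₗ[ℝ] E4}
    (hA : ∀ x y, form (A x) (A y) = form x y) :
    ShapeRel (fun w => A (f w)) (fun w => A (ν w)) u B := by
  intro v
  rw [covDeriv, fderiv_linear_comp A hf, fderiv_linear_comp A hν, hA, h v, covDeriv]
  simp

theorem NormalPair.comp {n : WithTop ℕ∞} {U O : Set E2} {f ν : E2 → E4} {ρ : E2 → E2}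
    (h : NormalPair n U f ν) (hn : n ≠ 0) (hO : IsOpen O) (hρ : ContDiffOn ℝ n ρ O)
    (hm : Set.MapsTo ρ O U) (hinj : ∀ w ∈ O, ∀ v, fderiv ℝ ρ w v = 0 → v = 0) :
    NormalPair n O (f ∘ ρ) (ν ∘ ρ) := by
  have hd : ∀ w ∈ O, ∀ v, fderiv ℝ (f ∘ ρ) w v = fderiv ℝ f (ρ w) (fderiv ℝ ρ w v) := by
    intro w hw v
    rw [fderiv_comp w (h.differentiableAt hn (hm hw))
      ((hρ.contDiffAt (hO.mem_nhds hw)).differentiableAt hn)]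
    rfl
  exact
  { isOpen := hO
    contDiffOn := h.contDiffOn.comp hρ hm
    contDiffOn_normal := h.contDiffOn_normal.comp hρ hm
    quadric := fun w hw => h.quadric _ (hm hw)
    spacelike := fun w hw v hv => by
      rw [hd w hw]; exact h.spacelike _ (hm hw) _ fun h0 => hv (hinj w hw v h0)
    tangent := fun w hw => h.tangent _ (hm hw)
    normal := fun w hw v => by rw [hd w hw]; exact h.normal _ (hm hw) _
    unit := fun w hw => h.unit _ (hm hw) }

theorem natCast_le_infty (k : ℕ) : (k : WithTop ℕ∞) ≤ ∞ :=
  WithTop.coe_le_coe.2 le_top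

/-- The maximum principle: on a surface of constant mean curvature, the determinant of the shape
operator is at least `-1` at each local minimum. -/
theorem neg_one_le_of_localMin {U : Set E2} {f ν : E2 → E4} {κ : E2 → ℝ} {τ : ℝ}
    (hp : NormalPair ∞ U f ν)
    (hB : ∀ w ∈ U, ∃ B, ShapeRel f ν w B ∧ LinearMap.trace ℝ E2 B = τ ∧ LinearMap.det B = κ w)
    {u : E2} (hu : u ∈ U) (hmin : ∀ᶠ w in 𝓝 u, κ u ≤ κ w) : -1 ≤ κ u := by
  have htop : (∞ : WithTop ℕ∞) ≠ 0 := by simp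
  have h2top : (2 : WithTop ℕ∞) ≤ ∞ := natCast_le_infty 2
  obtain ⟨B₀, hB₀, -, -⟩ := hB u hu
  obtain ⟨v₁, v₂, a, b, h11, h22, h12, hv1, -⟩ := hp.exists_principal_directions h2top hu hB₀
  -- An isometry brings the point, the principal directions and the normal to standard position.
  obtain ⟨A, hA, hAp, hA1, hA2, hAn⟩ := exists_frame_map (hp.quadric u hu) h11 h22 (hp.unit u hu)
    (hp.form_fderiv htop hu v₁) (hp.form_fderiv htop hu v₂) (hp.tangent u hu) h12
    (hp.normal u hu v₁) (hp.normal u hu v₂)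
  have hII : form (fderiv ℝ ν u v₁) (fderiv ℝ f u v₂) = 0 := by
    have := hp.form_shape htop hu hB₀ v₁ v₂
    rw [hv1, map_smul, form_smul_left, h12] at this
    linarith
  set F : E2 → E4 := fun w => A (f w) with hF
  set N : E2 → E4 := fun w => A (ν w) with hN
  have hP : NormalPair ∞ U F N := hp.map htop hA
  have hB' : ∀ w ∈ U, ∃ B, ShapeRel F N w B ∧ LinearMap.trace ℝ E2 B = τ ∧
      LinearMap.det B = κ w := by
    intro w hw
    obtain ⟨B, h1, h2, h3⟩ := hB w hw
    exact ⟨B, h1.map (hp.differentiableAt htop hw) (hp.differentiableAt_normal htop hw) hA, h2, h3⟩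
  have hF1 : fderiv ℝ F u v₁ = ![0, 1, 0, 0] := by
    rw [hF, fderiv_linear_comp A (hp.differentiableAt htop hu), hA1]
  have hF2 : fderiv ℝ F u v₂ = ![0, 0, 1, 0] := by
    rw [hF, fderiv_linear_comp A (hp.differentiableAt htop hu), hA2]
  have hFu : F u = ![1, 0, 0, 0] := hAp
  have hNu : N u = ![0, 0, 0, 1] := hAn
  -- The coordinates of the Klein model.
  let ψ : E2 → E2 := fun w => ![F w 1 / F w 0, F w 2 / F w 0]
  have hFi : ∀ w ∈ U, ∀ i, ContDiffAt ℝ ∞ (fun w => F w i) w := fun w hw i =>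
    contDiffAt_pi.1 (hP.contDiffAt hw) i
  have hψ : ∀ w ∈ U, F w 0 ≠ 0 → ContDiffAt ℝ ∞ ψ w := by
    intro w hw h0
    rw [contDiffAt_pi]
    intro i
    fin_cases i
    · exact (hFi w hw 1).div (hFi w hw 0) h0
    · exact (hFi w hw 2).div (hFi w hw 0) h0
  have hFu0 : F u 0 = 1 := by rw [hFu]; rfl
  have hFu0' : F u 0 ≠ 0 := by rw [hFu0]; exact one_ne_zero
  have hψu : ψ u = 0 := by
    ext i; fin_cases i <;> simp [ψ, hFu]
  have hF0 : ∀ᶠ w in 𝓝 u, F w 0 ≠ 0 := (hFi u hu 0).continuousAt.eventually_ne hFu0'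
  have hψd := (hψ u hu hFu0').differentiableAt htop
  have hψv : ∀ v, fderiv ℝ ψ u v 0 = fderiv ℝ F u v 1 ∧ fderiv ℝ ψ u v 1 = fderiv ℝ F u v 2 := by
    intro v
    have hc := hasFDerivAt_pi'.1 (hP.differentiableAt htop hu).hasFDerivAt
    have hd := hasFDerivAt_pi'.1 hψd.hasFDerivAt
    constructor
    · have e := (hc 1).unique (((hc 0).mul (hd 0)).congr_of_eventuallyEq
        (hF0.mono fun w hw => by simp [ψ, mul_div_cancel₀ _ hw]))
      have := congrArg (fun T : E2 →L[ℝ] ℝ => T v) e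
      simp [hψu, hFu0] at this
      exact this.symm
    · have e := (hc 2).unique (((hc 0).mul (hd 1)).congr_of_eventuallyEq
        (hF0.mono fun w hw => by simp [ψ, mul_div_cancel₀ _ hw]))
      have := congrArg (fun T : E2 →L[ℝ] ℝ => T v) e
      simp [hψu, hFu0] at this
      exact this.symm
  have hψ1 : fderiv ℝ ψ u v₁ = ex := by
    ext i; fin_cases i
    · simp [(hψv v₁).1, hF1, ex]
    · simp [(hψv v₁).2, hF1, ex]
  have hψ2 : fderiv ℝ ψ u v₂ = ey := by
    ext i; fin_cases i
    · simp [(hψv v₂).1, hF2, ey]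
    · simp [(hψv v₂).2, hF2, ey]
  have hψsurj : Function.Surjective (fderiv ℝ ψ u : E2 →ₗ[ℝ] E2) := fun v =>
    ⟨v 0 • v₁ + v 1 • v₂, by
      simp only [ContinuousLinearMap.coe_coe, map_add, map_smul, hψ1, hψ2]
      exact (eq_smul_ex_add_smul_ey v).symm⟩
  have hψinj : Function.Injective (fderiv ℝ ψ u : E2 →ₗ[ℝ] E2) :=
    LinearMap.injective_iff_surjective.2 hψsurj
  let L : E2 ≃L[ℝ] E2 := (LinearEquiv.ofInjectiveEndo _ hψinj).toContinuousLinearEquiv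
  have hL : HasFDerivAt ψ (L : E2 →L[ℝ] E2) u := by
    have : (L : E2 →L[ℝ] E2) = fderiv ℝ ψ u := ContinuousLinearMap.ext fun v => rfl
    rw [this]; exact hψd.hasFDerivAt
  have hψ4 : ContDiffAt ℝ (4 : ℕ) ψ u := (hψ u hu hFu0').of_le (natCast_le_infty 4)
  have h4 : ((4 : ℕ) : WithTop ℕ∞) ≠ 0 := by simp
  let ρ := hψ4.localInverse hL h4
  have hρ : ContDiffAt ℝ (4 : ℕ) ρ 0 := hψu ▸ hψ4.to_localInverse hL h4
  have hρ0 : ρ 0 = u := by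
    have := hψ4.localInverse_apply_image hL h4
    rwa [hψu] at this
  have hright : ∀ᶠ y in 𝓝 0, ψ (ρ y) = y := by
    have := (hψ4.hasStrictFDerivAt' hL h4).eventually_right_inverse
    rwa [hψu] at this
  have hcont : Tendsto ρ (𝓝 0) (𝓝 u) := by
    have := hρ.continuousAt.tendsto
    rwa [hρ0] at this
  obtain ⟨O, hOP, hO, h0O⟩ := eventually_nhds_iff.1 ((hright.and (hρ.eventually (by simp))).and
    ((hcont.eventually (hP.isOpen.mem_nhds hu)).and
      ((hcont.eventually hF0).and (hcont.eventually hmin))))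
  have hρO : ContDiffOn ℝ (4 : ℕ) ρ O := fun w hw => (hOP w hw).1.2.contDiffWithinAt
  have hm : Set.MapsTo ρ O U := fun w hw => (hOP w hw).2.1
  have hFO : ∀ w ∈ O, F (ρ w) 0 ≠ 0 := fun w hw => (hOP w hw).2.2.1
  have hψρ : ∀ w ∈ O, ∀ v, fderiv ℝ ψ (ρ w) (fderiv ℝ ρ w v) = v := by
    intro w hw v
    have e1 := ((hψ (ρ w) (hm hw) (hFO w hw)).differentiableAt htop).hasFDerivAt.comp w
      ((hOP w hw).1.2.differentiableAt h4).hasFDerivAt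
    have e2 := e1.unique ((hasFDerivAt_id w).congr_of_eventuallyEq
      (eventually_of_mem (hO.mem_nhds hw) fun y hy => (hOP y hy).1.1))
    exact congrArg (fun T : E2 →L[ℝ] E2 => T v) e2
  have hinj : ∀ w ∈ O, ∀ v, fderiv ℝ ρ w v = 0 → v = 0 := by
    intro w hw v hv
    rw [← hψρ w hw v, hv, map_zero]
  have hP4 : NormalPair (4 : ℕ) U F N :=
    { hP with
      contDiffOn := hP.contDiffOn.of_le (natCast_le_infty 4)
      contDiffOn_normal :=
        hP.contDiffOn_normal.of_le (natCast_le_infty 4) }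
  have hPO : NormalPair (4 : ℕ) O (F ∘ ρ) (N ∘ ρ) := hP4.comp h4 hO hρO hm hinj
  have hρ1 : fderiv ℝ ρ 0 ex = v₁ := by
    apply hψinj
    have := hψρ 0 h0O ex
    rw [hρ0] at this
    exact this.trans hψ1.symm
  have hρ2 : fderiv ℝ ρ 0 ey = v₂ := by
    apply hψinj
    have := hψρ 0 h0O ey
    rw [hρ0] at this
    exact this.trans hψ2.symm
  have hρd := hρ.differentiableAt h4
  have hco := fun i => contDiffOn_pi.1 hPO.contDiffOn i
  have key := neg_one_le_of_klein_min (Z := fun w => F (ρ w) 3 / F (ρ w) 0) (κ := κ ∘ ρ) (τ := τ)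
    hPO h0O ((hco 3).div (hco 0) hFO) ?_ ?_ ?_ ?_ ?_ ?_ ?_ ?_ ?_
  · simpa only [Function.comp_apply, hρ0] using key
  · intro w hw
    have := congrFun (hOP w hw).1.1 0
    rw [← this]
    simp [ψ, mul_div_cancel₀ _ (hFO w hw)]
  · intro w hw
    have := congrFun (hOP w hw).1.1 1
    rw [← this]
    simp [ψ, mul_div_cancel₀ _ (hFO w hw)]
  · intro w hw
    simp [mul_div_cancel₀ _ (hFO w hw)]
  · intro w hw
    obtain ⟨B, k1, k2, k3⟩ := hB' (ρ w) (hm hw)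
    have hi : Function.Injective (fderiv ℝ ρ w : E2 →ₗ[ℝ] E2) := by
      rw [← LinearMap.ker_eq_bot, LinearMap.ker_eq_bot']
      exact hinj w hw
    let M := LinearEquiv.ofInjectiveEndo _ hi
    refine ⟨M.symm.conj B, k1.comp (hP.differentiableAt htop (hm hw))
      (hP.differentiableAt_normal htop (hm hw)) ((hOP w hw).1.2.differentiableAt h4)
      fun v => rfl, ?_, ?_⟩
    · rw [LinearMap.trace_conj', k2]
    · rw [LinearEquiv.conj_apply, LinearMap.comp_assoc, LinearMap.det_conj, k3]; rfl
  · simp [hρ0, hFu0]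
  · simp [hρ0, hFu]
  · simp [hρ0, hNu]
  · rw [← hρ0] at hu
    rw [fderiv_comp 0 (hP.differentiableAt_normal htop hu) hρd,
      fderiv_comp 0 (hP.differentiableAt htop hu) hρd]
    simp only [ContinuousLinearMap.comp_apply, hρ1, hρ2]
    rw [hρ0] at hu ⊢
    rw [hF, hN, fderiv_linear_comp A (hp.differentiableAt htop hu),
      fderiv_linear_comp A (hp.differentiableAt_normal htop hu), hA, hII]
  · intro w hw
    have := (hOP w hw).2.2.2
    simpa only [Function.comp_apply, hρ0] using this

/-! ### Invariance of the shape operator under local isometries -/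

/-- The action of an isometry on the quadric. -/
def IsIsometry.act {A : E4 →ₗ[ℝ] E4} (hA : IsIsometry A) (x : Quadric) : Quadric :=
  ⟨A x, by rw [hA.form_map, x.2]⟩

theorem IsIsometry.continuous_act {A : E4 →ₗ[ℝ] E4} (hA : IsIsometry A) : Continuous hA.act :=
  (A.continuous_of_finiteDimensional.comp continuous_subtype_val).subtype_mk _

theorem isIsometry_neg : IsIsometry (-LinearMap.id) where
  form_map x y := by simp [form_neg_left, form_neg_right]
  future_map x v _ _ _ h := by
    have : timeField (-x) = -timeField x := by
      ext i; fin_cases i <;> simp [timeField]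
    simpa [IsFuture, this, form_neg_left, form_neg_right] using h

/-- The inverse of an isometry is an isometry: it preserves the time orientation since a tangent
time-like vector that is not future-directed is past-directed. -/
theorem IsIsometry.exists_inverse {A : E4 →ₗ[ℝ] E4} (hA : IsIsometry A) :
    ∃ (A' : E4 →ₗ[ℝ] E4), IsIsometry A' ∧ (∀ x, A' (A x) = x) ∧ ∀ x, A (A' x) = x := by
  obtain ⟨E, hE, hEs⟩ := exists_form_equiv hA.form_map
  have h1 : ∀ x, A (E.symm x) = x := fun x => by rw [← hE, E.apply_symm_apply]
  refine ⟨E.symm, ⟨hEs, fun x v hx hxv hv hf => ?_⟩, fun x => ?_, h1⟩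
  · change form (E.symm v) (timeField (E.symm x)) < 0
    have hx' : form (E.symm x) (E.symm x) = -1 := by rw [hEs, hx]
    have hxv' : form (E.symm x) (E.symm v) = 0 := by rw [hEs, hxv]
    have hv' : form (E.symm v) (E.symm v) < 0 := by rwa [hEs]
    by_contra hcon
    have hpos : 0 < form (E.symm v) (timeField (E.symm x)) :=
      lt_of_le_of_ne (not_lt.1 hcon) (form_timeField_ne_zero hx' hxv' hv').symm
    have hfut := hA.future_map (E.symm x) (-E.symm v) hx' (by rw [form_neg_right, hxv', neg_zero])
      (by rwa [form_neg_left, form_neg_right, neg_neg])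
      (by rw [IsFuture, form_neg_left]; linarith)
    rw [map_neg, h1, h1, IsFuture, form_neg_left] at hfut
    rw [IsFuture] at hf
    linarith
  · change E.symm (A x) = x
    rw [← hE, E.symm_apply_apply]

/-- A parametrization near one of its points, on a smaller domain. -/
theorem IsParamAt.restrict {T : Set Quadric} {x : Quadric} {U : Set E2} {f : E2 → E4} {u : E2}
    (h : IsParamAt T x U f u) {W : Set E2} (hW : IsOpen W) (hWU : W ⊆ U) {w : E2} (hw : w ∈ W)
    {z : Quadric} (hz : f w = z) : IsParamAt T z W f w where
  isOpen := hW
  mem := hw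
  apply_eq := hz
  contDiffOn := h.contDiffOn.mono hWU
  isEmbedding := h.isEmbedding.comp (Topology.IsEmbedding.inclusion hWU)
  spacelike w hw := h.spacelike w (hWU hw)
  image_eq := by
    obtain ⟨V, hV, -, hfV⟩ := h.image_eq
    obtain ⟨O, hO, hOW⟩ := h.isEmbedding.isInducing.isOpen_iff.1
      (hW.preimage (continuous_subtype_val : Continuous (Subtype.val : U → E2)))
    have hmem : ∀ y ∈ U, (f y ∈ O ↔ y ∈ W) := fun y hy => by
      have : (⟨y, hy⟩ : U) ∈ U.domRestrict f ⁻¹' O ↔ (⟨y, hy⟩ : U) ∈ Subtype.val ⁻¹' W := by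
        rw [hOW]
      exact this
    refine ⟨V ∩ Subtype.val ⁻¹' O, hV.inter (hO.preimage continuous_subtype_val), ⟨?_, ?_⟩, ?_⟩
    · obtain ⟨z', hz', hzw⟩ : f w ∈ Subtype.val '' (T ∩ V) := hfV ▸ ⟨w, hWU hw, rfl⟩
      rw [hz] at hzw
      rw [← Subtype.ext hzw]; exact hz'.2
    · change (z : E4) ∈ O
      rw [← hz]; exact (hmem w (hWU hw)).2 hw
    · ext y
      constructor
      · rintro ⟨w', hw', rfl⟩
        obtain ⟨z', hz', hzw⟩ : f w' ∈ Subtype.val '' (T ∩ V) := hfV ▸ ⟨w', hWU hw', rfl⟩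
        refine ⟨z', ⟨hz'.1, hz'.2, ?_⟩, hzw⟩
        change (z' : E4) ∈ O
        rw [hzw]; exact (hmem w' (hWU hw')).2 hw'
      · rintro ⟨z', ⟨hT, hVz, hOz⟩, rfl⟩
        obtain ⟨w', hw', hfw⟩ : (z' : E4) ∈ f '' U := by rw [hfV]; exact ⟨z', ⟨hT, hVz⟩, rfl⟩
        refine ⟨w', (hmem w' hw').1 ?_, hfw⟩
        rw [hfw]; exact hOz

/-- If an isometry sends `T` to `T'` near a point, it transports the shape operator. -/
theorem IsShapeOperatorAt.transfer {A : E4 →ₗ[ℝ] E4} (hA : IsIsometry A) {T T' : Set Quadric}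
    {x : Quadric} {B : E2 →ₗ[ℝ] E2} (hB : IsShapeOperatorAt T x B)
    (h : ∀ᶠ y in 𝓝 x, (y ∈ T ↔ hA.act y ∈ T')) : IsShapeOperatorAt T' (hA.act x) B := by
  obtain ⟨U, f, u, ν, hf, hν, hrel⟩ := hB
  have htop : (∞ : WithTop ℕ∞) ≠ 0 := by simp
  have hp := hf.normalPair hν
  obtain ⟨P, hPT, hP, hxP⟩ := eventually_nhds_iff.1 h
  obtain ⟨Q, hQ, rfl⟩ := isOpen_induced_iff.1 hP
  set W := U ∩ f ⁻¹' Q with hWdef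
  have hW : IsOpen W := hf.contDiffOn.continuousOn.isOpen_inter_preimage hf.isOpen hQ
  have hWU : W ⊆ U := Set.inter_subset_left
  have huW : u ∈ W := ⟨hf.mem, by change f u ∈ Q; rw [hf.apply_eq]; exact hxP⟩
  have hfW := hf.restrict hW hWU huW hf.apply_eq
  have hνW : IsFutureNormal W f ν :=
    ⟨hν.contDiffOn.mono hWU, fun w hw => hν.tangent w (hWU hw),
      fun w hw => hν.normal w (hWU hw), fun w hw => hν.unit w (hWU hw),
      fun w hw => hν.future w (hWU hw)⟩
  have hpA := (hfW.normalPair hνW).map htop hA.form_map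
  obtain ⟨A', hA', hleft, hright⟩ := hA.exists_inverse
  have hact : ∀ y, hA'.act (hA.act y) = y := fun y => Subtype.ext (hleft y)
  have hact' : ∀ y, hA.act (hA'.act y) = y := fun y => Subtype.ext (hright y)
  refine ⟨W, fun w => A (f w), u, fun w => A (ν w), ?_, ?_,
    ShapeRel.map hrel (hp.differentiableAt htop hf.mem) (hp.differentiableAt_normal htop hf.mem)
      hA.form_map⟩
  · refine ⟨hW, huW, ?_, hpA.contDiffOn, ?_, hpA.spacelike, ?_⟩
    · change A (f u) = A x
      rw [hf.apply_eq]
    · have hemb : Topology.IsEmbedding A :=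
        .of_leftInverse (f := A') hleft A'.continuous_of_finiteDimensional
          A.continuous_of_finiteDimensional
      exact hemb.comp hfW.isEmbedding
    · obtain ⟨V, hV, hxV, hfV⟩ := hfW.image_eq
      refine ⟨hA'.act ⁻¹' (V ∩ Subtype.val ⁻¹' Q),
        (hV.inter hP).preimage hA'.continuous_act, ?_, ?_⟩
      · rw [Set.mem_preimage, hact]; exact ⟨hxV, hxP⟩
      · ext y
        constructor
        · rintro ⟨w, hw, rfl⟩
          obtain ⟨z, hz, hzw⟩ : f w ∈ Subtype.val '' (T ∩ V) := hfV ▸ ⟨w, hw, rfl⟩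
          have hzQ : z ∈ Subtype.val ⁻¹' Q := by
            change (z : E4) ∈ Q
            rw [hzw]; exact hw.2
          refine ⟨hA.act z, ⟨(hPT z hzQ).1 hz.1, ?_⟩, ?_⟩
          · rw [Set.mem_preimage, hact]; exact ⟨hz.2, hzQ⟩
          · change A z = A (f w)
            rw [hzw]
        · rintro ⟨z, ⟨hzT, hzV⟩, rfl⟩
          have hz' : hA'.act z ∈ T := (hPT _ hzV.2).2 (by rwa [hact'])
          obtain ⟨w, hw, hfw⟩ : ((hA'.act z : Quadric) : E4) ∈ f '' W := by
            rw [hfV]; exact ⟨_, ⟨hz', hzV.1⟩, rfl⟩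
          refine ⟨w, hw, ?_⟩
          change A (f w) = z
          rw [hfw]; exact hright z
  · refine ⟨hpA.contDiffOn_normal, hpA.tangent, hpA.normal, hpA.unit, fun w hw => ?_⟩
    exact hA.future_map _ _ (hp.quadric w (hWU hw)) (hp.tangent w (hWU hw))
      (by rw [hp.unit w (hWU hw)]; norm_num) (hν.future w (hWU hw))

/-! ### The determinant of the shape operator as a function on the surface -/

open Classical in
/-- The determinant of the shape operator of `T` at `x`, or `0` if there is no shape operator. -/
def detShape (T : Set Quadric) (x : Quadric) : ℝ :=
  if h : ∃ B, IsShapeOperatorAt T x B then LinearMap.det h.choose else 0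

theorem IsShapeOperatorAt.detShape_eq {T : Set Quadric} {x : Quadric} {B : E2 →ₗ[ℝ] E2}
    (hB : IsShapeOperatorAt T x B) : detShape T x = LinearMap.det B := by
  have h : ∃ B, IsShapeOperatorAt T x B := ⟨B, hB⟩
  rw [detShape, dif_pos h]
  exact (h.choose_spec.invariants_eq hB).2.2

theorem detShape_transfer {A : E4 →ₗ[ℝ] E4} (hA : IsIsometry A) {T T' : Set Quadric}
    {x : Quadric} {B : E2 →ₗ[ℝ] E2} (hB : IsShapeOperatorAt T x B)
    (h : ∀ᶠ y in 𝓝 x, (y ∈ T ↔ hA.act y ∈ T')) : detShape T' (hA.act x) = detShape T x := by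
  rw [(hB.transfer hA h).detShape_eq, hB.detShape_eq]

theorem NormalPair.det_first_form_pos {n : WithTop ℕ∞} {U : Set E2} {f ν : E2 → E4} {w : E2}
    (h : NormalPair n U f ν) (hw : w ∈ U) :
    0 < form (fderiv ℝ f w ex) (fderiv ℝ f w ex) * form (fderiv ℝ f w ey) (fderiv ℝ f w ey) -
      form (fderiv ℝ f w ex) (fderiv ℝ f w ey) ^ 2 := by
  have hy := h.spacelike w hw ey (fun h => by simpa [ey] using congrFun h 1)
  have hv := h.spacelike w hw (form (fderiv ℝ f w ey) (fderiv ℝ f w ey) • ex -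
    form (fderiv ℝ f w ex) (fderiv ℝ f w ey) • ey)
    (fun h => hy.ne' (by simpa [ex, ey] using congrFun h 0))
  rw [map_sub, map_smul, map_smul, sub_eq_add_neg] at hv
  simp only [form_add_left, form_add_right, form_smul_left,
    form_smul_right, form_neg_left, form_neg_right,
    form_comm (fderiv ℝ f w ey) (fderiv ℝ f w ex)] at hv
  refine pos_of_mul_pos_right (a := form (fderiv ℝ f w ey) (fderiv ℝ f w ey)) ?_ hy.le
  linarith

/-- The determinant of the shape operator is the quotient of those of the second and the first
fundamental forms. -/
theorem NormalPair.det_shape {n : WithTop ℕ∞} {U : Set E2} {f ν : E2 → E4} {w : E2}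
    (h : NormalPair n U f ν) (hn : n ≠ 0) (hw : w ∈ U) {B : E2 →ₗ[ℝ] E2} (hB : ShapeRel f ν w B) :
    LinearMap.det B =
      (form (fderiv ℝ ν w ex) (fderiv ℝ f w ex) * form (fderiv ℝ ν w ey) (fderiv ℝ f w ey) -
      form (fderiv ℝ ν w ex) (fderiv ℝ f w ey) * form (fderiv ℝ ν w ey) (fderiv ℝ f w ex)) /
      (form (fderiv ℝ f w ex) (fderiv ℝ f w ex) * form (fderiv ℝ f w ey) (fderiv ℝ f w ey) -
      form (fderiv ℝ f w ex) (fderiv ℝ f w ey) ^ 2) := by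
  have key : ∀ v v', -form (fderiv ℝ ν w v) (fderiv ℝ f w v') =
      B v 0 * form (fderiv ℝ f w ex) (fderiv ℝ f w v') +
        B v 1 * form (fderiv ℝ f w ey) (fderiv ℝ f w v') := by
    intro v v'
    rw [← h.form_shape hn hw hB]
    conv_lhs => rw [eq_smul_ex_add_smul_ey (B v)]
    rw [map_add, map_smul, map_smul, form_add_left, form_smul_left, form_smul_left]
  have e00 := key ex ex
  have e01 := key ex ey
  have e10 := key ey ex
  have e11 := key ey ey
  rw [form_comm (fderiv ℝ f w ey) (fderiv ℝ f w ex)] at e00 e10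
  rw [eq_div_iff (h.det_first_form_pos hw).ne', (trace_det_eq B).2]
  linear_combination form (fderiv ℝ ν w ey) (fderiv ℝ f w ey) * e00
    - (B ex 0 * form (fderiv ℝ f w ex) (fderiv ℝ f w ex)
      + B ex 1 * form (fderiv ℝ f w ex) (fderiv ℝ f w ey)) * e11
    - form (fderiv ℝ ν w ey) (fderiv ℝ f w ex) * e01
    + (B ex 0 * form (fderiv ℝ f w ex) (fderiv ℝ f w ey)
      + B ex 1 * form (fderiv ℝ f w ey) (fderiv ℝ f w ey)) * e10

/-- The shape operators along a parametrization. -/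
theorem IsParamAt.exists_shapeRel {T : Set Quadric} {x : Quadric} {U : Set E2} {f ν : E2 → E4}
    {u : E2} (hf : IsParamAt T x U f u) (hν : IsFutureNormal U f ν) {w : E2} (hw : w ∈ U)
    {z : Quadric} (hz : f w = z) {B : E2 →ₗ[ℝ] E2} (hB : IsShapeOperatorAt T z B) :
    ∃ B', ShapeRel f ν w B' ∧ LinearMap.trace ℝ E2 B' = LinearMap.trace ℝ E2 B ∧
      LinearMap.det B' = detShape T z := by
  obtain ⟨L, hL⟩ := hB.exists_conj (hf.restrict hf.isOpen subset_rfl hw hz) hν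
  refine ⟨_, hL, LinearMap.trace_conj' _ _, ?_⟩
  rw [hB.detShape_eq, LinearEquiv.conj_apply, LinearMap.comp_assoc, LinearMap.det_conj]

theorem continuousOn_detShape {T : Set Quadric} (hT : ∀ z ∈ T, ∃ B, IsShapeOperatorAt T z B) :
    ContinuousOn (detShape T) T := by
  intro z hz
  obtain ⟨B, U, f, u, ν, hf, hν, -⟩ := hT z hz
  have htop : (∞ : WithTop ℕ∞) ≠ 0 := by simp
  have hp := hf.normalPair hν
  have hfc : ∀ v, ContinuousOn (fun w => fderiv ℝ f w v) U := fun v =>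
    (hp.contDiffOn.continuousOn_fderiv_of_isOpen hp.isOpen (natCast_le_infty 1)).clm_apply
      continuousOn_const
  have hνc : ∀ v, ContinuousOn (fun w => fderiv ℝ ν w v) U := fun v =>
    (hp.contDiffOn_normal.continuousOn_fderiv_of_isOpen hp.isOpen
      (natCast_le_infty 1)).clm_apply continuousOn_const
  have hform : ∀ {g h : E2 → E4}, ContinuousOn g U → ContinuousOn h U →
      ContinuousOn (fun w => form (g w) (h w)) U := fun hg hh =>
    continuous_form.comp_continuousOn (hg.prodMk hh)
  let k : E2 → ℝ := fun w =>
      (form (fderiv ℝ ν w ex) (fderiv ℝ f w ex) * form (fderiv ℝ ν w ey) (fderiv ℝ f w ey) -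
      form (fderiv ℝ ν w ex) (fderiv ℝ f w ey) * form (fderiv ℝ ν w ey) (fderiv ℝ f w ex)) /
      (form (fderiv ℝ f w ex) (fderiv ℝ f w ex) * form (fderiv ℝ f w ey) (fderiv ℝ f w ey) -
      form (fderiv ℝ f w ex) (fderiv ℝ f w ey) ^ 2)
  have hk : ContinuousOn k U :=
    (((hform (hνc ex) (hfc ex)).mul (hform (hνc ey) (hfc ey))).sub
      ((hform (hνc ex) (hfc ey)).mul (hform (hνc ey) (hfc ex)))).div
    (((hform (hfc ex) (hfc ex)).mul (hform (hfc ey) (hfc ey))).sub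
      ((hform (hfc ex) (hfc ey)).pow 2)) fun w hw => (hp.det_first_form_pos hw).ne'
  have hkd : ∀ w ∈ U, ∀ y ∈ T, f w = y → k w = detShape T y := by
    intro w hw y hy hwy
    obtain ⟨B, hB⟩ := hT y hy
    obtain ⟨B', hB', -, hd⟩ := hf.exists_shapeRel hν hw hwy hB
    rw [← hd, hp.det_shape htop hw hB']
  obtain ⟨V, hV, hzV, hfV⟩ := hf.image_eq
  change Tendsto _ _ _
  rw [tendsto_nhds]
  intro N hN hzN
  obtain ⟨O, hO, hOU⟩ := hf.isEmbedding.isInducing.isOpen_iff.1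
    (hN.preimage (continuousOn_iff_continuous_domRestrict.1 hk))
  have hmem : ∀ y (hy : y ∈ U), (f y ∈ O ↔ k y ∈ N) := fun y hy => by
    have : (⟨y, hy⟩ : U) ∈ U.domRestrict f ⁻¹' O ↔ (⟨y, hy⟩ : U) ∈ U.domRestrict k ⁻¹' N := by
      rw [hOU]
    exact this
  have hzO : (z : E4) ∈ O := by
    rw [← hf.apply_eq, hmem u hf.mem, hkd u hf.mem z hz hf.apply_eq]
    exact hzN
  rw [mem_nhdsWithin]
  refine ⟨V ∩ Subtype.val ⁻¹' O, hV.inter (hO.preimage continuous_subtype_val), ⟨hzV, hzO⟩, ?_⟩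
  rintro y ⟨⟨hyV, hyO⟩, hyT⟩
  obtain ⟨w, hw, hfw⟩ : (y : E4) ∈ f '' U := by rw [hfV]; exact ⟨y, ⟨hyT, hyV⟩, rfl⟩
  change detShape T y ∈ N
  rw [← hkd w hw y hyT hfw, ← hmem w hw, hfw]
  exact hyO

/-- The maximum principle for surfaces in the quadric. -/
theorem neg_one_le_of_forall_detShape_le {T : Set Quadric} {H : ℝ}
    (hT : ∀ z ∈ T, HasMeanCurvatureAt T z H) {z₀ : Quadric} (hz₀ : z₀ ∈ T)
    (hmin : ∀ z ∈ T, detShape T z₀ ≤ detShape T z) : -1 ≤ detShape T z₀ := by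
  classical
  obtain ⟨-, ⟨U, f, u, ν, hf, hν, -⟩, -⟩ := hT z₀ hz₀
  have hpt : ∀ w ∈ U, ∃ z ∈ T, f w = z := by
    intro w hw
    obtain ⟨V, -, -, hfV⟩ := hf.image_eq
    obtain ⟨z, hz, hzw⟩ : f w ∈ Subtype.val '' (T ∩ V) := hfV ▸ ⟨w, hw, rfl⟩
    exact ⟨z, hz.1, hzw.symm⟩
  let κ : E2 → ℝ := fun w => if h : form (f w) (f w) = -1 then detShape T ⟨f w, h⟩ else 0
  have hκ : ∀ w z, f w = Subtype.val z → κ w = detShape T z := by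
    rintro w ⟨z, hz⟩ rfl
    exact dif_pos hz
  rw [← hκ u z₀ hf.apply_eq]
  refine neg_one_le_of_localMin (τ := 2 * H) (hf.normalPair hν) (fun w hw => ?_) hf.mem ?_
  · obtain ⟨z, hz, hwz⟩ := hpt w hw
    obtain ⟨B, hB, htr⟩ := hT z hz
    obtain ⟨B', h1, h2, h3⟩ := hf.exists_shapeRel hν hw hwz hB
    exact ⟨B', h1, by rw [h2]; linarith, by rw [h3, hκ w z hwz]⟩
  · filter_upwards [hf.isOpen.mem_nhds hf.mem] with w hw
    obtain ⟨z, hz, hwz⟩ := hpt w hw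
    rw [hκ u z₀ hf.apply_eq, hκ w z hwz]
    exact hmin z hz

/-! ### Components of the preimage of a locally connected set under a covering -/

/-- Each point has an open neighborhood `N` such that through each point over `N` there passes a
section of the covering over `N`, which is a local inverse. -/
theorem exists_local_sections {X M : Type*} [TopologicalSpace X]
    [TopologicalSpace M] {p : X → M} (hp : IsCoveringMap p) (q : M) :
    ∃ N, IsOpen N ∧ q ∈ N ∧ ∀ y, p y ∈ N → ∃ s : M → X, ContinuousOn s N ∧ s (p y) = y ∧
      (∀ m ∈ N, p (s m) = m) ∧ ∀ᶠ y' in 𝓝 y, s (p y') = y' := by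
  classical
  obtain ⟨hI, N, hqN, hN, hpN, h, hh⟩ := hp q
  refine ⟨N, hN, hqN, fun y hy => ?_⟩
  let i := (h ⟨y, hy⟩).2
  let s : M → X := fun m => if hm : m ∈ N then (h.symm (⟨m, hm⟩, i) : X) else y
  have hs : ∀ m (hm : m ∈ N), s m = h.symm (⟨m, hm⟩, i) := fun m hm => dif_pos hm
  have hinv : ∀ y' (hy' : p y' ∈ N), (h ⟨y', hy'⟩).2 = i → s (p y') = y' := by
    intro y' hy' hi
    rw [hs _ hy', ← hi]
    have : ((⟨p y', hy'⟩ : N), (h ⟨y', hy'⟩).2) = h ⟨y', hy'⟩ :=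
      Prod.ext (Subtype.ext (hh ⟨y', hy'⟩).symm) rfl
    rw [this, h.symm_apply_apply]
  refine ⟨s, ?_, hinv y hy rfl, fun m hm => ?_, ?_⟩
  · rw [continuousOn_iff_continuous_domRestrict]
    have : N.domRestrict s = fun m : N => (h.symm (m, i) : X) := by
      ext m; exact hs m m.2
    rw [this]
    fun_prop
  · rw [hs m hm, ← hh, h.apply_symm_apply]
  · have hopen : IsOpen {y' : p ⁻¹' N | (h y').2 = i} :=
      (isOpen_discrete {i}).preimage (continuous_snd.comp h.continuous)
    have hopen' := hpN.isOpenMap_subtype_val _ hopen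
    refine eventually_of_mem (hopen'.mem_nhds ⟨⟨y, hy⟩, rfl, rfl⟩) ?_
    rintro _ ⟨⟨y', hy'⟩, hi, rfl⟩
    exact hinv y' hy' hi

/-- Each point of `F` has arbitrarily small connected neighborhoods in `F`. -/
def LocallyConnectedOn {M : Type*} [TopologicalSpace M] (F : Set M) : Prop :=
  ∀ q ∈ F, ∀ N ∈ 𝓝 q, ∃ G ⊆ N ∩ F, IsPreconnected G ∧ q ∈ G ∧ G ∈ 𝓝[F] q

theorem apply_mem_of_mem_component {X M : Type*} [TopologicalSpace X] {p : X → M} {F : Set M}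
    {x y : X} (hy : y ∈ connectedComponentIn (p ⁻¹' F) x) : p y ∈ F :=
  connectedComponentIn_subset (p ⁻¹' F) x hy

section Components

variable {X M : Type*} [TopologicalSpace X] [TopologicalSpace M] {p : X → M} {F : Set M} {x y : X}

theorem subset_component_of_section {C : Set X} (hC : C = connectedComponentIn (p ⁻¹' F) x)
    (hy : y ∈ C) {G N : Set M} {s : M → X} (hG : IsPreconnected G) (hGN : G ⊆ N ∩ F)
    (hs : ContinuousOn s N) (hsp : ∀ m ∈ N, p (s m) = m) (hyG : p y ∈ G) (hsy : s (p y) = y) :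
    s '' G ⊆ C := by
  subst hC
  rw [connectedComponentIn_eq hy]
  refine (hG.image s (hs.mono fun m hm => (hGN hm).1)).subset_connectedComponentIn
    ⟨p y, hyG, hsy⟩ ?_
  rintro _ ⟨m, hm, rfl⟩
  change p (s m) ∈ F
  rw [hsp m (hGN hm).1]
  exact (hGN hm).2

/-- A component of the preimage is open in the preimage. -/
theorem eventually_mem_component (hp : IsCoveringMap p) (hF : LocallyConnectedOn F)
    (hy : y ∈ connectedComponentIn (p ⁻¹' F) x) :
    ∀ᶠ y' in 𝓝 y, p y' ∈ F → y' ∈ connectedComponentIn (p ⁻¹' F) x := by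
  obtain ⟨N, hN, hyN, hsec⟩ := exists_local_sections hp (p y)
  obtain ⟨s, hs, hsy, hsp, hloc⟩ := hsec y hyN
  have hyF : p y ∈ F := apply_mem_of_mem_component hy
  obtain ⟨G, hGN, hG, hyG, hGF⟩ := hF (p y) hyF N (hN.mem_nhds hyN)
  have hsub := subset_component_of_section rfl hy hG hGN hs hsp hyG hsy
  filter_upwards [hloc, hp.continuous.continuousAt.eventually (mem_nhdsWithin_iff_eventually.1 hGF)]
    with y' h1 h2 h3
  rw [← h1]
  exact hsub ⟨p y', h2 h3, rfl⟩

/-- The projection of a component of the preimage is closed. -/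
theorem isClosed_image_component (hp : IsCoveringMap p) (hF : LocallyConnectedOn F)
    (hFc : IsClosed F) : IsClosed (p '' connectedComponentIn (p ⁻¹' F) x) := by
  have hCF : p '' connectedComponentIn (p ⁻¹' F) x ⊆ F := by
    rintro _ ⟨y, hy, rfl⟩
    exact apply_mem_of_mem_component hy
  refine isClosed_of_closure_subset fun q hq => ?_
  have hqF : q ∈ F := hFc.closure_subset_iff.2 hCF hq
  obtain ⟨N, hN, hqN, hsec⟩ := exists_local_sections hp q
  obtain ⟨G, hGN, hG, hqG, hGF⟩ := hF q hqF N (hN.mem_nhds hqN)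
  obtain ⟨O, hO, hqO, hOG⟩ := mem_nhdsWithin.1 hGF
  obtain ⟨_, hyO, y, hy, rfl⟩ := mem_closure_iff.1 hq O hO hqO
  have hyG : p y ∈ G := hOG ⟨hyO, apply_mem_of_mem_component hy⟩
  obtain ⟨s, hs, hsy, hsp, -⟩ := hsec y (hGN hyG).1
  exact ⟨s q, subset_component_of_section rfl hy hG hGN hs hsp hyG hsy ⟨q, hqG, rfl⟩, hsp q hqN⟩

end Components

/-- Embedded surfaces are locally connected. -/
theorem IsSpacelikeSurfaceIn.locallyConnectedOn {M : Type*} [TopologicalSpace M]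
    [ChartedSpace Quadric M] {F : Set M} (hF : IsSpacelikeSurfaceIn F) : LocallyConnectedOn F := by
  intro q hq N hN
  set e := chartAt Quadric q with he
  have hqe : q ∈ e.source := mem_chart_source Quadric q
  obtain ⟨U, f, u, hf⟩ := hF e (chart_mem_atlas Quadric q) (e q) ⟨q, ⟨hq, hqe⟩, rfl⟩
  have hP : e.target ∩ e.symm ⁻¹' N ∈ 𝓝 (e q) := by
    refine inter_mem (e.open_target.mem_nhds (e.map_source hqe)) ?_
    refine (e.continuousAt_symm (e.map_source hqe)).preimage_mem_nhds ?_
    rwa [e.left_inv hqe]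
  obtain ⟨P, hPs, hP, hqP⟩ := mem_nhds_iff.1 hP
  obtain ⟨Q, hQ, rfl⟩ := isOpen_induced_iff.1 hP
  have hUQ : IsOpen (U ∩ f ⁻¹' Q) :=
    hf.contDiffOn.continuousOn.isOpen_inter_preimage hf.isOpen hQ
  have huQ : u ∈ U ∩ f ⁻¹' Q := ⟨hf.mem, by change f u ∈ Q; rw [hf.apply_eq]; exact hqP⟩
  -- The image of a small ball of parameters is connected.
  obtain ⟨ε, hε, hball⟩ := Metric.isOpen_iff.1 hUQ u huQ
  have hfB := hf.restrict Metric.isOpen_ball (fun w hw => (hball hw).1)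
    (Metric.mem_ball_self hε) hf.apply_eq
  obtain ⟨V, hV, hqV, hfV⟩ := hfB.image_eq
  set T := e '' (F ∩ e.source) with hT
  have hconn : IsPreconnected (T ∩ V) := by
    have hind : Topology.IsInducing (Subtype.val : Quadric → E4) := .subtypeVal
    rw [← hind.isPreconnected_image, ← hfV]
    exact (convex_ball u ε).isPreconnected.image f hfB.contDiffOn.continuousOn
  have hsub : T ∩ V ⊆ e.target ∩ e.symm ⁻¹' N := by
    intro y hy
    apply hPs
    obtain ⟨w, hw, hwy⟩ : (y : E4) ∈ f '' Metric.ball u ε := by rw [hfV]; exact ⟨y, hy, rfl⟩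
    change (y : E4) ∈ Q
    rw [← hwy]; exact (hball hw).2
  refine ⟨e.symm '' (T ∩ V), ?_, ?_, ?_, ?_⟩
  · rintro _ ⟨y, hy, rfl⟩
    refine ⟨(hsub hy).2, ?_⟩
    obtain ⟨m, hm, rfl⟩ := hy.1
    rw [e.left_inv hm.2]; exact hm.1
  · exact hconn.image _ (e.continuousOn_symm.mono fun y hy => (hsub hy).1)
  · exact ⟨e q, ⟨⟨q, ⟨hq, hqe⟩, rfl⟩, hqV⟩, e.left_inv hqe⟩
  · rw [mem_nhdsWithin]
    refine ⟨e.source ∩ e ⁻¹' V, e.isOpen_inter_preimage hV, ⟨hqe, hqV⟩, ?_⟩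
    rintro m ⟨⟨hme, hmV⟩, hmF⟩
    exact ⟨e m, ⟨⟨m, ⟨hmF, hme⟩, rfl⟩, hmV⟩, e.left_inv hme⟩

/-! ### The local structure of a lift -/

theorem continuous_proj : Continuous proj := continuous_quotient_mk'

theorem proj_eq_iff {z z' : Quadric} : proj z = proj z' ↔ (z : E4) = z' ∨ (z : E4) = -(z' : E4) :=
  Quotient.eq (r := antipodalSetoid)

theorem proj_surjective : Function.Surjective proj := Quotient.mk_surjective

/-- The covering of `AdS₃` by the quadric is locally injective. -/
theorem exists_injOn_proj (z₀ : Quadric) : ∃ P, IsOpen P ∧ z₀ ∈ P ∧ Set.InjOn proj P := by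
  have hc : Continuous fun z : Quadric => form z z₀ :=
    continuous_form.comp (continuous_subtype_val.prodMk continuous_const)
  refine ⟨{z | form z z₀ < 0}, isOpen_lt hc continuous_const, ?_, fun z hz z' hz' h => ?_⟩
  · rw [Set.mem_ofPred_eq, z₀.2]; norm_num
  · rcases proj_eq_iff.1 h with h | h
    · exact Subtype.ext h
    · rw [Set.mem_ofPred_eq] at hz hz'
      rw [h, form_neg_left] at hz
      linarith

section Lift

variable {M X : Type*} [TopologicalSpace M] [ChartedSpace Quadric M] [TopologicalSpace X]
  {F : Set M} {p : X → M} {dev : X → AdS3} {x y : X}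

/-- Near each of its points, the preimage in the quadric of a lift of `F` is the image of `F` under
a chart followed by an isometry. The embedding hypothesis prevents other parts of the lift from
coming close. -/
theorem exists_local_structure (hp : IsCoveringMap p) (hF : LocallyConnectedOn F)
    (hdev : IsDevelopingMap p dev)
    (hemb : Topology.IsEmbedding ((connectedComponentIn (p ⁻¹' F) x).domRestrict dev))
    (hy : y ∈ connectedComponentIn (p ⁻¹' F) x) :
    ∃ (A : E4 →ₗ[ℝ] E4) (hA : IsIsometry A),
      dev y = proj (hA.act (chartAt Quadric (p y) (p y))) ∧
      ∀ᶠ q in 𝓝 (p y),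
        (q ∈ F ↔ hA.act (chartAt Quadric (p y) q) ∈
          proj ⁻¹' (dev '' connectedComponentIn (p ⁻¹' F) x)) ∧
        (q ∈ F → ∃ y' ∈ connectedComponentIn (p ⁻¹' F) x, p y' = q ∧
          dev y' = proj (hA.act (chartAt Quadric (p y) q))) := by
  set C := connectedComponentIn (p ⁻¹' F) x with hC
  set e := chartAt Quadric (p y) with he
  have hye : p y ∈ e.source := mem_chart_source Quadric (p y)
  obtain ⟨A, hA, hdA⟩ := hdev y
  have hdA : ∀ᶠ y' in 𝓝 y, dev y' = proj (hA.act (e (p y'))) := by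
    filter_upwards [hdA] with y' ⟨z, hz, hzd⟩
    rw [hzd]
    exact congrArg proj (Subtype.ext hz)
  refine ⟨A, hA, hdA.self_of_nhds, ?_⟩
  obtain ⟨N, hN, hyN, hsec⟩ := exists_local_sections hp (p y)
  obtain ⟨s, hs, hsy, hsp, hloc⟩ := hsec y hyN
  have hst : Tendsto s (𝓝 (p y)) (𝓝 y) := by
    have := (hs.continuousAt (hN.mem_nhds hyN)).tendsto
    rwa [hsy] at this
  have hpt : Tendsto p (𝓝 y) (𝓝 (p y)) := hp.continuous.continuousAt
  have hcont : Tendsto (fun q => hA.act (e q)) (𝓝 (p y)) (𝓝 (hA.act (e (p y)))) :=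
    (hA.continuous_act.continuousAt.tendsto).comp (e.continuousAt hye)
  -- The developing map is injective on a neighborhood `D` of `y`.
  obtain ⟨D, hD, hyD, hDinj⟩ : ∃ D, IsOpen D ∧ y ∈ D ∧ Set.InjOn dev D := by
    obtain ⟨A', hA', hleft, -⟩ := hA.exists_inverse
    obtain ⟨P, hPo, hzP, hP⟩ := exists_injOn_proj (hA.act (e (p y)))
    obtain ⟨D, hDs, hD, hyD⟩ := eventually_nhds_iff.1 ((hdA.and hloc).and
      ((hpt.eventually (e.open_source.mem_nhds hye)).and
        ((hcont.comp hpt).eventually (hPo.mem_nhds hzP))))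
    refine ⟨D, hD, hyD, fun a ha b hb hab => ?_⟩
    obtain ⟨⟨a1, a2⟩, a3, a4⟩ := hDs a ha
    obtain ⟨⟨b1, b2⟩, b3, b4⟩ := hDs b hb
    rw [a1, b1] at hab
    have h1 := hP a4 b4 hab
    have h2 : e (p a) = e (p b) := by
      apply Subtype.ext
      rw [← hleft (e (p a)), ← hleft (e (p b))]
      exact congrArg A' (congrArg Subtype.val h1)
    rw [← a2, ← b2, e.injOn a3 b3 h2]
  obtain ⟨O, hO, hOD⟩ := hemb.isInducing.isOpen_iff.1
    (hD.preimage (continuous_subtype_val : Continuous (Subtype.val : C → X)))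
  have hmem : ∀ c ∈ C, (dev c ∈ O ↔ c ∈ D) := fun c hc => by
    have : (⟨c, hc⟩ : C) ∈ C.domRestrict dev ⁻¹' O ↔ (⟨c, hc⟩ : C) ∈ Subtype.val ⁻¹' D := by
      rw [hOD]
    exact this
  have hyO : proj (hA.act (e (p y))) ∈ O := by
    rw [← hdA.self_of_nhds]; exact (hmem y hy).2 hyD
  filter_upwards [hst.eventually hdA, hst.eventually (eventually_mem_component hp hF hy),
    hst.eventually (hD.mem_nhds hyD), hN.mem_nhds hyN,
    ((continuous_proj.continuousAt.tendsto).comp hcont).eventually (hO.mem_nhds hyO)]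
    with q h1 h2 h3 h4 h5
  rw [hsp q h4] at h1 h2
  refine ⟨⟨fun hq => ⟨s q, h2 hq, h1⟩, ?_⟩, fun hq => ⟨s q, h2 hq, hsp q h4, h1⟩⟩
  rintro ⟨c, hc, hcd⟩
  have hcD : c ∈ D := (hmem c hc).1 (by rw [hcd]; exact h5)
  have : c = s q := hDinj hcD h3 (by rw [hcd, h1])
  have hcF := apply_mem_of_mem_component hc
  rwa [this, hsp q h4] at hcF

/-- The determinant of the shape operator of a lift of `F` is the pull-back of a function on `M`. -/
theorem detShape_eq_of_apply_eq (hp : IsCoveringMap p) (hF : LocallyConnectedOn F)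
    (hdev : IsDevelopingMap p dev)
    (hemb : Topology.IsEmbedding ((connectedComponentIn (p ⁻¹' F) x).domRestrict dev))
    {T : Set Quadric} (hTdef : T = proj ⁻¹' (dev '' connectedComponentIn (p ⁻¹' F) x))
    (hT : ∀ z ∈ T, ∃ B, IsShapeOperatorAt T z B) {y y' : X}
    (hy : y ∈ connectedComponentIn (p ⁻¹' F) x) (hy' : y' ∈ connectedComponentIn (p ⁻¹' F) x)
    (hyy' : p y = p y') {z z' : Quadric} (hz : proj z = dev y) (hz' : proj z' = dev y') :
    detShape T z = detShape T z' := by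
  have hneg : ∀ {z z' : Quadric}, z ∈ T → proj z = proj z' → detShape T z = detShape T z' := by
    intro z z' hz h
    rcases proj_eq_iff.1 h with h | h
    · rw [Subtype.ext h]
    · have hact : ∀ w, proj (isIsometry_neg.act w) = proj w := fun w => proj_eq_iff.2 (Or.inr rfl)
      obtain ⟨B, hB⟩ := hT z hz
      have := detShape_transfer (T' := T) isIsometry_neg hB (Eventually.of_forall fun w => by
        rw [hTdef, Set.mem_preimage, Set.mem_preimage, hact])
      rw [← this]
      congr 1
      refine Subtype.ext ?_
      change -(z : E4) = z'
      rw [h, neg_neg]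
  obtain ⟨A₁, h₁, hd₁, hl₁⟩ := exists_local_structure hp hF hdev hemb hy
  obtain ⟨A₂, h₂, hd₂, hl₂⟩ := exists_local_structure hp hF hdev hemb hy'
  rw [← hyy'] at hd₂ hl₂
  set e := chartAt Quadric (p y) with he
  have hye : p y ∈ e.source := mem_chart_source Quadric (p y)
  obtain ⟨A', hA', hleft, hright⟩ := h₁.exists_inverse
  have hz₁T : h₁.act (e (p y)) ∈ T := by
    rw [hTdef, Set.mem_preimage, ← hd₁]; exact ⟨y, hy, rfl⟩
  have hz₂T : h₂.act (e (p y)) ∈ T := by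
    rw [hTdef, Set.mem_preimage, ← hd₂]; exact ⟨y', hy', rfl⟩
  have hzz₁ := hneg hz₁T (by rw [hz, hd₁])
  have hzz₂ := hneg hz₂T (by rw [hz', hd₂])
  rw [← hzz₁, ← hzz₂]
  -- The isometry `A₂ ∘ A₁⁻¹` sends `T` to `T` near the two points.
  have hact : hA'.act (h₁.act (e (p y))) = e (p y) := Subtype.ext (hleft _)
  have hcomp : (h₂.comp hA').act (h₁.act (e (p y))) = h₂.act (e (p y)) :=
    Subtype.ext (congrArg A₂ (hleft _))
  obtain ⟨B, hB⟩ := hT _ hz₁T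
  rw [← hcomp]
  refine (detShape_transfer (h₂.comp hA') hB ?_).symm
  have hta : Tendsto hA'.act (𝓝 (h₁.act (e (p y)))) (𝓝 (e (p y))) := by
    have := hA'.continuous_act.continuousAt (x := h₁.act (e (p y)))
    rwa [ContinuousAt, hact] at this
  have htm : Tendsto e.symm (𝓝 (e (p y))) (𝓝 (p y)) := by
    have := e.continuousAt_symm (e.map_source hye)
    rwa [ContinuousAt, e.left_inv hye] at this
  filter_upwards [hta.eventually (e.open_target.mem_nhds (e.map_source hye)),
    (htm.comp hta).eventually hl₁, (htm.comp hta).eventually hl₂] with w k1 k2 k3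
  have hw1 : e (e.symm (hA'.act w)) = hA'.act w := e.right_inv k1
  have hw2 : h₁.act (hA'.act w) = w := Subtype.ext (hright _)
  have hw3 : (h₂.comp hA').act w = h₂.act (hA'.act w) := rfl
  simp only [Function.comp_apply] at k2 k3
  rw [hw1] at k2 k3
  rw [hw2] at k2
  rw [hw3, hTdef, ← k2.1, ← k3.1]

/-- The determinant of the shape operator of a lift of a compact surface has a minimum. -/
theorem exists_min_detShape [T2Space M] (hp : IsCoveringMap p) (hF : LocallyConnectedOn F)
    (hFc : IsCompact F) (hdev : IsDevelopingMap p dev)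
    (hemb : Topology.IsEmbedding ((connectedComponentIn (p ⁻¹' F) x).domRestrict dev))
    (hx : x ∈ p ⁻¹' F) {T : Set Quadric}
    (hTdef : T = proj ⁻¹' (dev '' connectedComponentIn (p ⁻¹' F) x))
    (hT : ∀ z ∈ T, ∃ B, IsShapeOperatorAt T z B) :
    ∃ z₀ ∈ T, ∀ z ∈ T, detShape T z₀ ≤ detShape T z := by
  classical
  set C := connectedComponentIn (p ⁻¹' F) x with hC
  let K : M → ℝ := fun q =>
    if h : ∃ r, ∃ y ∈ C, ∃ z, p y = q ∧ proj z = dev y ∧ r = detShape T z then h.choose else 0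
  have hK : ∀ y ∈ C, ∀ z, proj z = dev y → K (p y) = detShape T z := by
    intro y hy z hz
    have h : ∃ r, ∃ y' ∈ C, ∃ z, p y' = p y ∧ proj z = dev y' ∧ r = detShape T z :=
      ⟨_, y, hy, z, rfl, hz, rfl⟩
    obtain ⟨y', hy', z', hp', hz', hr⟩ := h.choose_spec
    have hKy : K (p y) = h.choose := dif_pos h
    rw [hKy, hr]
    exact detShape_eq_of_apply_eq hp hF hdev hemb hTdef hT hy' hy hp' hz' hz
  have hcomp : IsCompact (p '' C) :=
    hFc.of_isClosed_subset (isClosed_image_component hp hF hFc.isClosed) (by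
      rintro _ ⟨y, hy, rfl⟩
      exact apply_mem_of_mem_component hy)
  have hcont : ContinuousOn K (p '' C) := by
    rintro _ ⟨y, hy, rfl⟩
    obtain ⟨A, hA, hd, hl⟩ := exists_local_structure hp hF hdev hemb hy
    set e := chartAt Quadric (p y) with he
    have hye : p y ∈ e.source := mem_chart_source Quadric (p y)
    have hzT : hA.act (e (p y)) ∈ T := by
      rw [hTdef, Set.mem_preimage, ← hd]; exact ⟨y, hy, rfl⟩
    have hle : 𝓝[p '' C] (p y) ≤ 𝓝 (p y) := nhdsWithin_le_nhds
    have hev : ∀ᶠ q in 𝓝[p '' C] (p y),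
        hA.act (e q) ∈ T ∧ detShape T (hA.act (e q)) = K q := by
      filter_upwards [hle hl, self_mem_nhdsWithin] with q hq hqC
      obtain ⟨c, hc, rfl⟩ := hqC
      have hcF := apply_mem_of_mem_component hc
      obtain ⟨y', hy', hpy', hdy'⟩ := hq.2 hcF
      refine ⟨by rw [hTdef]; exact hq.1.1 hcF, ?_⟩
      rw [← hK y' hy' _ hdy'.symm, hpy']
    have hte : Tendsto (fun q => hA.act (e q)) (𝓝[p '' C] (p y)) (𝓝[T] (hA.act (e (p y)))) := by
      refine tendsto_nhdsWithin_iff.2 ⟨?_, hev.mono fun q hq => hq.1⟩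
      exact ((hA.continuous_act.continuousAt.tendsto).comp (e.continuousAt hye)).mono_left hle
    have := (continuousOn_detShape hT _ hzT).tendsto.comp hte
    change Tendsto K _ _
    rw [hK y hy _ hd.symm]
    exact this.congr' (hev.mono fun q hq => hq.2)
  have hxC : x ∈ C := mem_connectedComponentIn hx
  obtain ⟨_, ⟨y₀, hy₀, rfl⟩, hmin⟩ := hcomp.exists_isMinOn ⟨p x, x, hxC, rfl⟩ hcont
  obtain ⟨z₀, hz₀⟩ := proj_surjective (dev y₀)
  refine ⟨z₀, by rw [hTdef, Set.mem_preimage, hz₀]; exact ⟨y₀, hy₀, rfl⟩, fun z hz => ?_⟩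
  rw [hTdef] at hz
  obtain ⟨y, hy, hyz⟩ := hz
  rw [← hK y₀ hy₀ z₀ hz₀, ← hK y hy z hyz.symm]
  exact hmin ⟨y, hy, rfl⟩

end Lift

/-- Estimate of the principal curvatures by their mean `H` and their product. -/
theorem principal_curvature_bounds {H l₁ l₂ : ℝ} (h : l₂ ≤ l₁) (hH : l₁ + l₂ = 2 * H)
    (hK : -1 ≤ l₁ * l₂) :
    (H ≤ l₁ ∧ l₁ ≤ √(H ^ 2 + 1) + H) ∧ (-√(H ^ 2 + 1) + H ≤ l₂ ∧ l₂ ≤ H) := by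
  have h1 : l₁ - H ≤ √(H ^ 2 + 1) := by
    apply Real.le_sqrt_of_sq_le
    have : l₂ = 2 * H - l₁ := by linarith
    subst this
    nlinarith
  exact ⟨⟨by linarith, by linarith⟩, by linarith, by linarith⟩

end AdS

end

theorem mainTheorem9 {M : Type*} [TopologicalSpace M] [ChartedSpace AdS.Quadric M]
    [AdS.AdSManifold M] (hM : AdS.IsGHMC M)
    (F : Set M) (hF : AdS.IsSpacelikeSurfaceIn F) (hFc : IsCompact F)
    (H : ℝ) (S : Set AdS.AdS3) (hS : AdS.IsHSurface H S) (hlift : AdS.IsLift F S) :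
    ∀ x ∈ AdS.proj ⁻¹' S,
      (∃ l₁ l₂, AdS.ArePrincipalCurvaturesAt (AdS.proj ⁻¹' S) x l₁ l₂) ∧
      ∀ l₁ l₂, AdS.ArePrincipalCurvaturesAt (AdS.proj ⁻¹' S) x l₁ l₂ →
        (H ≤ l₁ ∧ l₁ ≤ Real.sqrt (H ^ 2 + 1) + H) ∧
        (-Real.sqrt (H ^ 2 + 1) + H ≤ l₂ ∧ l₂ ≤ H) := by
  obtain ⟨X, _, _, p, dev, x₀, hp, hdev, hx₀, hemb, hSdef⟩ := hlift
  have hT : ∀ z ∈ AdS.proj ⁻¹' S, ∃ B, AdS.IsShapeOperatorAt (AdS.proj ⁻¹' S) z B :=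
    fun z hz => (hS.2 z hz).imp fun B hB => hB.1
  obtain ⟨z₀, hz₀, hmin⟩ := AdS.exists_min_detShape hp hF.locallyConnectedOn hFc hdev hemb hx₀
    (congrArg (AdS.proj ⁻¹' ·) hSdef) hT
  have hK := AdS.neg_one_le_of_forall_detShape_le hS.2 hz₀ hmin
  intro x hx
  obtain ⟨B, hB, htr⟩ := hS.2 x hx
  refine ⟨?_, ?_⟩
  · obtain ⟨U, f, u, ν, hf, hν, hrel⟩ := id hB
    obtain ⟨a, b, hab, hchar⟩ :=
      (hf.normalPair hν).exists_charpoly_eq (AdS.natCast_le_infty 2) hf.mem hrel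
    exact ⟨a, b, hab, B, hB, hchar⟩
  · rintro l₁ l₂ ⟨hl, B', hB', hchar⟩
    obtain ⟨htr', hdet⟩ := AdS.trace_det_of_charpoly hchar
    refine AdS.principal_curvature_bounds hl ?_ ?_
    · rw [← htr', ← (hB.invariants_eq hB').2.1]; linarith
    · rw [← hdet, ← hB'.detShape_eq]
      exact hK.trans (hmin x hx)
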